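/- Let $N$ be a positive integer. For $X=(X_1,\dots,X_N)\in\{0,1\}^N$ let $H_X$ be the Hamiltonian on the span of the orthonormal basis $|k,j\rangle$, $k\in\{0,1\}$, $0\le j\le N$, whose only nonzero matrix entries are $$\langle k',j+1|H_X|k,j\rangle=\langle k,j|H_X|k',j+1\rangle=\tfrac12\sqrt{(N-j)(j+1)}\qquad\text{for } 0\le j<N,\ k\oplus k'=X_{j+1}$$ (a spin-$N/2$ $J_x$ chain on two lines that cross at the positions where $X_{j+1}=1$). (i) The family is row-computable: there is one program which, given $N$, a row $x=(k,j)$, an index $i\in\{1,2\}$, a precision $p$ and random access to the bits of $X$, computes the position $y_i$ of the $i$-th nonzero entry of the row and the value $(H_X)_{x,y_i}$ to within $2^{-p}$, in time polynomial in $\log N$ and $p$. Here the nonzero entries of row $(k,j)$ are listed with the one towards $j+1$ first and then the one towards $j-1$, as far as they exist; an index $i$ larger than the number of nonzero entries returns $(x,0)$. (ii) Each $H_X$ is Hermitian and $2$-sparse (at most two nonzero entries in each row and column), and for $t=\pi$ the scaled time is $\tau=\|H_X\|t=\pi N/2$, with $\|\cdot\|$ the spectral norm. (iii) Let $f_X(x,i)=(y_i,(H_X)_{x,y_i})$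 be the black-box function that lists the rows of $H_X$ as in (i). Consider a quantum algorithm, not depending on $X$, that makes $Q$ queries to the unitary $|x,i\rangle|z\rangle\mapsto|x,i\rangle|z\oplus f_X(x,i)\rangle$ (answers being written as bit strings in any fixed encoding), with arbitrary unitaries and ancillas in between. If for every $X\in\{0,1\}^N$ and every initial pure state $|\psi\rangle$ the final state of the system is within trace distance $1/4$ of $e^{-iH_Xt}|\psi\rangle$, where $t=\pi$ and $\tau=\pi N/2$, then $Q\ge\tau/2\pi$. Consequently, no black-box simulation can scale sublinearly in $\tau$: if $g:\mathbb R\to\mathbb R$ is such that for every positive integer $N$ some algorithm as in (iii) simulates all $H_X$, $X\in\{0,1\}^N$, for scaled time $\pi N/2$ within trace distance $1/4$ with at most $g(\pi N/2)$ queries, then $g(\tau)$ is not $o(\tau)$ as $\tau\to\infty$. -/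

import Mathlib

noncomputable section

namespace HamSim

/-! ### Sparse Hamiltonians and row oracles -/

/-- At most `d` nonzero entries in each row and in each column. -/
def IsSparse {S : Type} (d : ℕ) (H : Matrix S S ℂ) : Prop :=
  ∀ x, {y | H x y ≠ 0}.encard ≤ d ∧ {y | H y x ≠ 0}.encard ≤ d

/-- `f` is a black-box function for `H`: if the nonzero entries of row `x` are in the positions
`y₁, …, y_m` (listed without repetition, `m ≤ d`), then `f x i = (y_i, H x y_i)` for the first `m`
indices `i`, and `f x i = (x, 0)` for the others. (Indices start at `0`.) -/
def IsRowOracle {S : Type} {d : ℕ} (H : Matrix S S ℂ) (f : S → Fin d → S × ℂ) : Prop :=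
  ∀ x, ∃ m ≤ d,
    Set.InjOn (fun i => (f x i).1) {i : Fin d | i.val < m} ∧
    (∀ i : Fin d, i.val < m → H x (f x i).1 ≠ 0 ∧ (f x i).2 = H x (f x i).1) ∧
    (∀ y, H x y ≠ 0 → ∃ i : Fin d, i.val < m ∧ (f x i).1 = y) ∧
    (∀ i : Fin d, m ≤ i.val → f x i = (x, 0))

/-- The scaled time `τ = ‖H‖ t`, with the spectral norm (operator norm on `ℓ²`). -/
def scaledTime {S : Type} [Fintype S] [DecidableEq S] (H : Matrix S S ℂ) (t : ℝ) : ℝ :=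
  ‖Matrix.toEuclideanCLM (𝕜 := ℂ) H‖ * t

/-! ### Trace distance -/

/-- Half the sum of the singular values of `ρ - σ`, that is `(1/2) Tr |ρ - σ|`. -/
def traceDist {S : Type} [Fintype S] [DecidableEq S] (ρ σ : Matrix S S ℂ) : ℝ :=
  (1 / 2) * ∑ i, Real.sqrt ((Matrix.isHermitian_conjTranspose_mul_self (ρ - σ)).eigenvalues i)

/-- The operator `|ψ⟩⟨ψ|`. -/
def pureState {S : Type} (ψ : S → ℂ) : Matrix S S ℂ :=
  Matrix.vecMulVec ψ (star ψ)

/-! ### Quantum algorithms with queries to a row oracle -/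

/-- The ancillary basis labels: a work register of dimension `w`, the query register `(x, i)`, and
an answer register of `b` qubits. -/
abbrev Anc (S : Type) (d b w : ℕ) : Type :=
  Fin w × (S × Fin d) × (Fin b → Bool)

/-- One call of the black box on the whole register,
`|s, w, (x, i), z⟩ ↦ |s, w, (x, i), z ⊕ enc (f x i)⟩`, on amplitudes. Here `enc` writes an answer
(a position and a matrix entry) as a `b`-bit string. This unitary is its own inverse. -/
def oracleStep {S : Type} {d b w : ℕ} (enc : S × ℂ → Fin b → Bool) (f : S → Fin d → S × ℂ)
    (φ : S × Anc S d b w → ℂ) : S × Anc S d b w → ℂ :=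
  fun a => φ (a.1, a.2.1, a.2.2.1,
    fun l => xor (a.2.2.2 l) (enc (f a.2.2.1.1 a.2.2.1.2) l))

/-- A quantum query algorithm on a system with basis `S`: a number of queries, a work space, a
starting basis state of the ancillary registers, and the unitaries `V 0, V 1, …` that are applied
before, between and after the queries. None of these depends on the black box. -/
structure QueryAlg (S : Type) [Fintype S] [DecidableEq S] (d b : ℕ) where
  queries : ℕ
  w : ℕ
  start : Anc S d b w
  V : ℕ → Matrix.unitaryGroup (S × Anc S d b w) ℂ

namespace QueryAlg

variable {S : Type} [Fintype S] [DecidableEq S] {d b : ℕ}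

/-- The joint state after `m` queries, from the initial system state `ψ`. -/
def state (A : QueryAlg S d b) (enc : S × ℂ → Fin b → Bool) (f : S → Fin d → S × ℂ)
    (ψ : S → ℂ) : ℕ → S × Anc S d b A.w → ℂ
  | 0 => Matrix.mulVec (A.V 0 : Matrix (S × Anc S d b A.w) (S × Anc S d b A.w) ℂ)
      (fun a => if a.2 = A.start then ψ a.1 else 0)
  | m + 1 => Matrix.mulVec (A.V (m + 1) : Matrix (S × Anc S d b A.w) (S × Anc S d b A.w) ℂ)
      (oracleStep enc f (A.state enc f ψ m))

/-- The final reduced density operator of the system. -/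
def output (A : QueryAlg S d b) (enc : S × ℂ → Fin b → Bool) (f : S → Fin d → S × ℂ)
    (ψ : S → ℂ) : Matrix S S ℂ :=
  fun s s' => ∑ e, A.state enc f ψ A.queries (s, e) * star (A.state enc f ψ A.queries (s', e))

/-- With the black box `f`, the algorithm simulates `e^{-iHt}` with error at most `ε` in trace
distance, for every initial pure state. -/
def Simulates (A : QueryAlg S d b) (enc : S × ℂ → Fin b → Bool) (f : S → Fin d → S × ℂ)
    (H : Matrix S S ℂ) (t ε : ℝ) : Prop :=
  ∀ ψ : S → ℂ, ∑ s, ‖ψ s‖ ^ 2 = 1 →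
    traceDist (A.output enc f ψ)
      (pureState (Matrix.mulVec (NormedSpace.exp ((-(Complex.I * (t : ℂ))) • H)) ψ)) ≤ ε

end QueryAlg

/-! ### The two crossing lines -/

/-- Basis labels `(k, j)` with `k` a bit and `0 ≤ j ≤ N`. -/
abbrev Site (N : ℕ) : Type := Bool × Fin (N + 1)

/-- `bit X j` is the bit of `X` on the link between positions `j` and `j + 1`
(`false` out of range). -/
def bit {N : ℕ} (X : Fin N → Bool) (j : ℕ) : Bool :=
  if h : j < N then X ⟨j, h⟩ else false

/-- The matrix entry of `J_x` for spin `N / 2` between positions `j` and `j + 1`. -/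
def weight (N j : ℕ) : ℝ := Real.sqrt (((N : ℝ) - j) * (j + 1)) / 2

/-- The Hamiltonian with entry `weight N j` between `(k, j)` and `(k', j + 1)` whenever `k ⊕ k'`
is the bit of `X` on the link from `j` to `j + 1`, and no other nonzero entries. -/
def chainH (N : ℕ) (X : Fin N → Bool) : Matrix (Site N) (Site N) ℂ :=
  fun x y =>
    if y.2.val = x.2.val + 1 ∧ xor x.1 y.1 = bit X x.2.val then (weight N x.2.val : ℂ)
    else if x.2.val = y.2.val + 1 ∧ xor x.1 y.1 = bit X y.2.val then (weight N y.2.val : ℂ)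
    else 0

/-- The nonzero entries of row `(k, j)`: first the one towards `j + 1`, then the one towards
`j - 1`, as far as they exist. -/
def chainRowList (N : ℕ) (X : Fin N → Bool) (x : Site N) : List (Site N × ℂ) :=
  (if h : x.2.val < N then
    [((xor x.1 (bit X x.2.val), (⟨x.2.val + 1, by omega⟩ : Fin (N + 1))),
      (weight N x.2.val : ℂ))] else []) ++
  (if 0 < x.2.val then
    [((xor x.1 (bit X (x.2.val - 1)), (⟨x.2.val - 1, by omega⟩ : Fin (N + 1))),
      (weight N (x.2.val - 1) : ℂ))] else [])

/-- The black-box function of `chainH N X`. -/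
def chainRow (N : ℕ) (X : Fin N → Bool) (x : Site N) (i : Fin 2) : Site N × ℂ :=
  (chainRowList N X x).getD i.val (x, 0)

/-! ### Efficient computation: a register machine with logarithmic cost

Programs work on registers holding natural numbers, and have random access to a bit string. -/

inductive Prog : Type
  | const (r c : ℕ)
  | add (r a b : ℕ)
  | sub (r a b : ℕ)
  | mul (r a b : ℕ)
  | div (r a b : ℕ)
  | read (r a : ℕ)
  | seq (p q : Prog)
  | ite (a : ℕ) (p q : Prog)
  | loop (a : ℕ) (p : Prog)

/-- `Exec X p s s' c`: with random-access input `X`, the program `p` started on the registers `s`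
halts with the registers `s'` at cost `c`. Each elementary step costs one plus the total bit
length of its operands. The loop runs while register `a` is nonzero; subtraction is truncated. -/
inductive Exec (X : ℕ → Bool) : Prog → (ℕ → ℕ) → (ℕ → ℕ) → ℕ → Prop
  | const (r c : ℕ) (s : ℕ → ℕ) :
      Exec X (.const r c) s (Function.update s r c) (1 + c.size)
  | add (r a b : ℕ) (s : ℕ → ℕ) :
      Exec X (.add r a b) s (Function.update s r (s a + s b)) (1 + (s a).size + (s b).size)
  | sub (r a b : ℕ) (s : ℕ → ℕ) :
      Exec X (.sub r a b) s (Function.update s r (s a - s b)) (1 + (s a).size + (s b).size)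
  | mul (r a b : ℕ) (s : ℕ → ℕ) :
      Exec X (.mul r a b) s (Function.update s r (s a * s b)) (1 + (s a).size + (s b).size)
  | div (r a b : ℕ) (s : ℕ → ℕ) :
      Exec X (.div r a b) s (Function.update s r (s a / s b)) (1 + (s a).size + (s b).size)
  | read (r a : ℕ) (s : ℕ → ℕ) :
      Exec X (.read r a) s (Function.update s r (X (s a)).toNat) (1 + (s a).size)
  | seq (p q : Prog) (s s' s'' : ℕ → ℕ) (c c' : ℕ) :
      Exec X p s s' c → Exec X q s' s'' c' → Exec X (.seq p q) s s'' (c + c')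
  | iteTrue (a : ℕ) (p q : Prog) (s s' : ℕ → ℕ) (c : ℕ) :
      s a ≠ 0 → Exec X p s s' c → Exec X (.ite a p q) s s' (1 + (s a).size + c)
  | iteFalse (a : ℕ) (p q : Prog) (s s' : ℕ → ℕ) (c : ℕ) :
      s a = 0 → Exec X q s s' c → Exec X (.ite a p q) s s' (1 + (s a).size + c)
  | loopDone (a : ℕ) (p : Prog) (s : ℕ → ℕ) :
      s a = 0 → Exec X (.loop a p) s s 1
  | loopStep (a : ℕ) (p : Prog) (s s' s'' : ℕ → ℕ) (c c' : ℕ) :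
      s a ≠ 0 → Exec X p s s' c → Exec X (.loop a p) s' s'' c' →
      Exec X (.loop a p) s s'' (1 + (s a).size + c + c')

/-- Initial registers: `N`, the row `x = (k, j)`, the index `i` and the precision `p` in the
registers `0, …, 4`; all others are zero. -/
def inputRegs {N d : ℕ} (x : Site N) (i : Fin d) (p : ℕ) : ℕ → ℕ
  | 0 => N
  | 1 => x.1.toNat
  | 2 => x.2.val
  | 3 => i.val
  | 4 => p
  | _ => 0

/-- A family of Hamiltonians on `Site N`, encoding bit strings of length `N` and given by their
row functions, is row-computable: one program, with random access to the bit string, computes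
the position (registers `0`, `1`) and the matrix entry to within `2^{-p}` (as the complex dyadic
number in registers `2, …, 5`, real part `(s 2 - s 3) / 2^p`, imaginary part `(s 4 - s 5) / 2^p`),
at a cost polynomial in `p` and in the number of bits of `N` (hence in the number of qubits). -/
def RowComputable {d : ℕ} (f : (N : ℕ) → (Fin N → Bool) → Site N → Fin d → Site N × ℂ) : Prop :=
  ∃ (P : Prog) (C : ℕ), ∀ (N : ℕ) (X : Fin N → Bool) (x : Site N) (i : Fin d) (p : ℕ),
    ∃ (s : ℕ → ℕ) (c : ℕ), Exec (bit X) P (inputRegs x i p) s c ∧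
      c ≤ C * (N.size + p + 1) ^ C ∧
      s 0 = (f N X x i).1.1.toNat ∧
      s 1 = (f N X x i).1.2.val ∧
      ‖(((s 2 : ℂ) - (s 3 : ℂ)) + ((s 4 : ℂ) - (s 5 : ℂ)) * Complex.I) / 2 ^ p - (f N X x i).2‖
        ≤ 1 / 2 ^ p

end HamSim

end

/-!
The lower bound is the polynomial method for parity. A query to the row oracle reveals at most one
bit of `X`, so after `m` queries every amplitude is a polynomial of degree at most `m` in the bits
(`state_mem_degLE`), and every expectation value in the output has degree at most `2 * m`. On the
other hand, the two crossing lines compute parity: the entries of the Hamiltonian are those of the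
spin operator `J_x`, and `J_x` rotates the coherent state at position `0` into the one at position
`N` in time `π`, while the crossings switch the line once for every bit that is set
(`exp_pi_chainH_mulVec`). The evolution is found by writing down the coherent state at time `t` and
checking the Schrödinger equation (`hasDerivAt_coherentAmp`).

A simulation within trace distance `1/4` thus gives a polynomial of degree at most `2 * m` that is
within `1/2` of the sign `(-1)^(X₁ + ⋯ + X_N)` everywhere. This uses trace-norm duality
(`norm_sum_mul_diag_le`) for the observable with values `1` and `-1` at the far ends of the two
lines. A polynomial of degree less than `N` is orthogonal to the sign
(`sum_paritySign_mul_eq_zero`), hence `N ≤ 2 * m` (`le_two_mul_queries`), which is more than the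
bound `τ / 2π = N / 4`.

The norm of the Hamiltonian is `N / 2` by the Schur test with the positive eigenvector
`√(N choose j)` (`norm_chainH`). The rows are computed by a program that finds the link, computes
`2 ^ p` by repeated doubling and an integer square root by bisection. All registers keep a length
linear in `N.size + p + 1`, and so does the number of rounds of each loop, which makes the cost
quadratic (`rowComputable_chainRow`).
-/

namespace HamSim

/-! ### Low-degree functions of a bit string -/

/-- The functions of a bit string that are represented by a polynomial of degree at most `m`,
encoded as the span of the functions that depend on at most `m` bits. -/
def degLE (ι : Type) (m : ℕ) : Submodule ℂ ((ι → Bool) → ℂ) :=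
  Submodule.span ℂ {F | ∃ T : Finset ι, T.card ≤ m ∧ DependsOn F T}

section LowDegree

variable {ι : Type}

lemma mem_degLE_of_dependsOn {m : ℕ} {F : (ι → Bool) → ℂ} {T : Finset ι}
    (hT : T.card ≤ m) (hF : DependsOn F T) : F ∈ degLE ι m :=
  Submodule.subset_span ⟨T, hT, hF⟩

lemma const_mem_degLE (m : ℕ) (c : ℂ) : (fun _ => c) ∈ degLE ι m :=
  mem_degLE_of_dependsOn (T := ∅) (by simp) (by simpa using dependsOn_const c)

lemma mul_mem_degLE {m n : ℕ} {F G : (ι → Bool) → ℂ} (hF : F ∈ degLE ι m)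
    (hG : G ∈ degLE ι n) : F * G ∈ degLE ι (m + n) := by
  classical
  induction hF using Submodule.span_induction with
  | zero => simp
  | add F₁ F₂ _ _ h₁ h₂ => rw [add_mul]; exact add_mem h₁ h₂
  | smul c F _ h => rw [smul_mul_assoc]; exact Submodule.smul_mem _ c h
  | mem F hF =>
    obtain ⟨T, hT, hFT⟩ := hF
    induction hG using Submodule.span_induction with
    | zero => simp
    | add G₁ G₂ _ _ h₁ h₂ => rw [mul_add]; exact add_mem h₁ h₂
    | smul c G _ h => rw [mul_smul_comm]; exact Submodule.smul_mem _ c h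
    | mem G hG =>
      obtain ⟨U, hU, hGU⟩ := hG
      refine mem_degLE_of_dependsOn (T := T ∪ U)
        ((Finset.card_union_le _ _).trans (by omega)) fun X Y h => ?_
      have h₁ : F X = F Y := hFT fun i hi => h i (by simp [Finset.mem_coe.1 hi])
      have h₂ : G X = G Y := hGU fun i hi => h i (by simp [Finset.mem_coe.1 hi])
      simp [h₁, h₂]

lemma star_mem_degLE {m : ℕ} {F : (ι → Bool) → ℂ} (hF : F ∈ degLE ι m) :
    star F ∈ degLE ι m := by
  induction hF using Submodule.span_induction with
  | zero => simp
  | add F₁ F₂ _ _ h₁ h₂ => rw [star_add]; exact add_mem h₁ h₂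
  | smul c F _ h => rw [star_smul]; exact Submodule.smul_mem _ _ h
  | mem F hF =>
    obtain ⟨T, hT, hFT⟩ := hF
    exact mem_degLE_of_dependsOn hT fun X Y h => by simp [hFT h]

/-- The parity character `(-1)^(X₁ + ⋯ + X_N)`. -/
def paritySign [Fintype ι] (X : ι → Bool) : ℂ := ∏ i, if X i then -1 else 1

lemma paritySign_mul_self [Fintype ι] (X : ι → Bool) : paritySign X * paritySign X = 1 := by
  rw [paritySign, ← Finset.prod_mul_distrib]
  exact Finset.prod_eq_one fun i _ => by split_ifs <;> simp

/-- Parity is orthogonal to every function of smaller degree: a function that ignores bit `i`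
takes equal values at `X` and at `X` with bit `i` flipped, where the parities are opposite. -/
lemma sum_paritySign_mul_eq_zero [Fintype ι] [DecidableEq ι] {m : ℕ} (hm : m < Fintype.card ι)
    {F : (ι → Bool) → ℂ} (hF : F ∈ degLE ι m) : ∑ X, paritySign X * F X = 0 := by
  induction hF using Submodule.span_induction with
  | zero => simp
  | add F₁ F₂ _ _ h₁ h₂ => simp [mul_add, Finset.sum_add_distrib, h₁, h₂]
  | smul c F _ h =>
    simp only [Pi.smul_apply, smul_eq_mul, mul_left_comm _ c, ← Finset.mul_sum, h, mul_zero]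
  | mem F hF =>
    obtain ⟨T, hT, hFT⟩ := hF
    obtain ⟨i, hi⟩ : ∃ i, i ∉ T := by
      by_contra! h
      have : T = Finset.univ := Finset.eq_univ_iff_forall.2 h
      rw [this, Finset.card_univ] at hT
      omega
    refine Finset.sum_involution (fun X _ => Function.update X i (!X i)) ?_ ?_ ?_ ?_
    · intro X _
      have h₁ : F (Function.update X i (!X i)) = F X := hFT fun l hl =>
        Function.update_of_ne (fun h : l = i => hi (h ▸ Finset.mem_coe.1 hl)) _ _
      have h₂ : paritySign (Function.update X i (!X i)) = -paritySign X := by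
        unfold paritySign
        rw [← Finset.mul_prod_erase _ _ (Finset.mem_univ i),
          ← Finset.mul_prod_erase _ (fun l => if X l then (-1 : ℂ) else 1) (Finset.mem_univ i),
          Finset.prod_congr rfl (g := fun l => if X l then (-1 : ℂ) else 1)]
        · cases h : X i <;> simp
        · intro l hl
          rw [Function.update_of_ne (Finset.ne_of_mem_erase hl)]
      rw [h₁, h₂]; ring
    · intro X _ _ h
      have := congrFun h i
      simp at this
    · simp
    · simp

end LowDegree

/-! ### Amplitudes of a query algorithm -/

section Amplitudes

variable {ι S : Type} [Fintype S] [DecidableEq S] {d b : ℕ}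

/-- If each answer of the black box depends on at most one bit of `X`, then the amplitudes after
`m` queries have degree at most `m`: an oracle call multiplies amplitudes by indicators of
answers, which have degree at most one, and the unitaries in between act linearly. -/
lemma state_mem_degLE (A : QueryAlg S d b) (enc : S × ℂ → Fin b → Bool)
    (f : (ι → Bool) → S → Fin d → S × ℂ)
    (hf : ∀ x i, ∃ T : Finset ι, T.card ≤ 1 ∧ DependsOn (fun X => f X x i) T)
    (ψ : S → ℂ) (m : ℕ) (a : S × Anc S d b A.w) :
    (fun X => A.state enc (f X) ψ m a) ∈ degLE ι m := by
  induction m generalizing a with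
  | zero => exact const_mem_degLE _ _
  | succ m ih =>
    have key : ∀ a, (fun X => oracleStep enc (f X) (A.state enc (f X) ψ m) a)
        ∈ degLE ι (m + 1) := by
      rintro ⟨s, w, ⟨x, i⟩, z⟩
      obtain ⟨T, hT, hfT⟩ := hf x i
      have : (fun X => oracleStep enc (f X) (A.state enc (f X) ψ m) (s, w, (x, i), z)) =
          ∑ z' : Fin b → Bool, (fun X => A.state enc (f X) ψ m (s, w, (x, i), z')) *
            (fun X => if z' = fun l => xor (z l) (enc (f X x i) l) then (1 : ℂ) else 0) := by
        funext X
        simp [oracleStep, Finset.sum_apply]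
      rw [this]
      refine Submodule.sum_mem _ fun z' _ => mul_mem_degLE (ih _) ?_
      exact mem_degLE_of_dependsOn hT fun X Y h => by
        have := hfT h
        simp only at this
        simp only [this]
    have : (fun X => A.state enc (f X) ψ (m + 1) a) =
        ∑ a', (A.V (m + 1) : Matrix _ _ ℂ) a a' •
          (fun X => oracleStep enc (f X) (A.state enc (f X) ψ m) a') := by
      funext X
      simp [QueryAlg.state, Matrix.mulVec, dotProduct, Finset.sum_apply]
    rw [this]
    exact Submodule.sum_mem _ fun a' _ => Submodule.smul_mem _ _ (key a')

lemma output_mem_degLE (A : QueryAlg S d b) (enc : S × ℂ → Fin b → Bool)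
    (f : (ι → Bool) → S → Fin d → S × ℂ)
    (hf : ∀ x i, ∃ T : Finset ι, T.card ≤ 1 ∧ DependsOn (fun X => f X x i) T)
    (ψ : S → ℂ) (s s' : S) :
    (fun X => A.output enc (f X) ψ s s') ∈ degLE ι (2 * A.queries) := by
  have : (fun X => A.output enc (f X) ψ s s') =
      ∑ e, (fun X => A.state enc (f X) ψ A.queries (s, e)) *
        star (fun X => A.state enc (f X) ψ A.queries (s', e)) := by
    funext X
    simp [QueryAlg.output, Finset.sum_apply]
  rw [this, two_mul]
  exact Submodule.sum_mem _ fun e _ =>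
    mul_mem_degLE (state_mem_degLE A enc f hf ψ _ _)
      (star_mem_degLE (state_mem_degLE A enc f hf ψ _ _))

end Amplitudes

/-! ### Trace distance bounds differences of expectation values -/

/-- Trace-norm duality for diagonal observables: in an orthonormal eigenbasis `u` of `M† M` the
trace of `D M` is the sum of `⟨D† u_i, M u_i⟩`, and `‖M u_i‖` is the `i`-th singular value. -/
lemma norm_sum_mul_diag_le {S : Type} [Fintype S] [DecidableEq S] (M : Matrix S S ℂ)
    (D : S → ℂ) (hD : ∀ s, ‖D s‖ ≤ 1) :
    ‖∑ s, D s * M s s‖ ≤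
      ∑ i, Real.sqrt ((Matrix.isHermitian_conjTranspose_mul_self M).eigenvalues i) := by
  set hM := Matrix.isHermitian_conjTranspose_mul_self M
  set u := hM.eigenvectorBasis
  set U : Matrix S S ℂ := (hM.eigenvectorUnitary : Matrix S S ℂ) with hU
  have hUU : U * star U = 1 := Unitary.coe_mul_star_self _
  have htr : ∑ s, D s * M s s = ∑ i, ∑ s, star (star (D s) * u i s) * (M.mulVec (u i)) s := by
    have h1 : ∑ s, D s * M s s = (star U * (Matrix.diagonal D * M * U)).trace := by
      rw [Matrix.trace_mul_comm, Matrix.mul_assoc, hUU, Matrix.mul_one]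
      simp [Matrix.trace, Matrix.diagonal_mul]
    rw [h1, Matrix.trace]
    refine Finset.sum_congr rfl fun i _ => ?_
    rw [Matrix.diag_apply, Matrix.mul_apply]
    refine Finset.sum_congr rfl fun s _ => ?_
    rw [Matrix.mul_assoc, Matrix.diagonal_mul, Matrix.mul_apply]
    simp only [Matrix.star_apply, hU, Matrix.IsHermitian.eigenvectorUnitary_apply, Matrix.mulVec,
      dotProduct, star_mul, star_star, u]
    ring
  rw [htr]
  refine (norm_sum_le _ _).trans (Finset.sum_le_sum fun i _ => ?_)
  set y : EuclideanSpace ℂ S := WithLp.toLp 2 (fun s => star (D s) * u i s)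
  set v : EuclideanSpace ℂ S := WithLp.toLp 2 (M.mulVec (u i))
  have h1 : ∑ s, star (star (D s) * u i s) * (M.mulVec (u i)) s = inner ℂ y v := by
    simp [PiLp.inner_apply, y, v, mul_comm]
  have hui : ‖u i‖ = 1 := u.orthonormal.1 i
  have h2 : ‖y‖ ≤ 1 := by
    rw [← hui, EuclideanSpace.norm_eq, EuclideanSpace.norm_eq]
    refine Real.sqrt_le_sqrt (Finset.sum_le_sum fun s _ => ?_)
    have : ‖y s‖ ≤ ‖u i s‖ := by
      simp only [y, norm_mul, norm_star]
      exact mul_le_of_le_one_left (norm_nonneg _) (hD s)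
    gcongr
  have h3 : ‖v‖ = Real.sqrt (hM.eigenvalues i) := by
    rw [EuclideanSpace.norm_eq]
    congr 1
    have e1 : star (u i : S → ℂ) ⬝ᵥ (M.conjTranspose * M).mulVec (u i) = hM.eigenvalues i := by
      rw [hM.mulVec_eigenvectorBasis i, dotProduct_smul]
      have : star (u i : S → ℂ) ⬝ᵥ (u i : S → ℂ) = 1 := by
        have h := inner_self_eq_norm_sq_to_K (𝕜 := ℂ) (u i)
        rw [hui, EuclideanSpace.inner_eq_star_dotProduct, dotProduct_comm] at h
        simpa using h
      simp [u] at this ⊢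
      rw [this, mul_one]
    rw [← Matrix.mulVec_mulVec, Matrix.dotProduct_mulVec, Matrix.vecMul_conjTranspose,
      star_star] at e1
    have e2 : ((∑ s, ‖v s‖ ^ 2 : ℝ) : ℂ) = hM.eigenvalues i := by
      rw [← e1]
      simp only [dotProduct, v]
      push_cast
      refine Finset.sum_congr rfl fun s _ => ?_
      simp [← Complex.conj_mul']
    exact_mod_cast e2
  rw [h1]
  refine (norm_inner_le_norm _ _).trans ?_
  rw [h3]
  exact mul_le_of_le_one_left (Real.sqrt_nonneg _) h2

lemma norm_sum_mul_diag_sub_le_traceDist {S : Type} [Fintype S] [DecidableEq S]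
    (ρ σ : Matrix S S ℂ) (D : S → ℂ) (hD : ∀ s, ‖D s‖ ≤ 1) :
    ‖∑ s, D s * ρ s s - ∑ s, D s * σ s s‖ ≤ 2 * traceDist ρ σ := by
  have e : ∑ s, D s * ρ s s - ∑ s, D s * σ s s = ∑ s, D s * (ρ - σ) s s := by
    simp only [Matrix.sub_apply, mul_sub, Finset.sum_sub_distrib]
  rw [e, traceDist, ← mul_assoc, mul_one_div_cancel two_ne_zero, one_mul]
  exact norm_sum_mul_diag_le (ρ - σ) D hD

/-! ### The black box of the crossing lines -/

section Chain

variable {N : ℕ}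

lemma chainRow_forward (X : Fin N → Bool) (x : Site N) (i : Fin 2) (hi : i.val = 0)
    (hx : x.2.val < N) :
    chainRow N X x i = ((xor x.1 (bit X x.2.val), ⟨x.2.val + 1, by omega⟩),
      (weight N x.2.val : ℂ)) := by
  simp [chainRow, chainRowList, hi, hx]

lemma chainRow_backward (X : Fin N → Bool) (x : Site N) (i : Fin 2)
    (hx : 0 < x.2.val) (hi : i.val = 1 ↔ x.2.val < N) :
    chainRow N X x i = ((xor x.1 (bit X (x.2.val - 1)), ⟨x.2.val - 1, by omega⟩),
      (weight N (x.2.val - 1) : ℂ)) := by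
  by_cases h : x.2.val < N
  · simp [chainRow, chainRowList, hi.2 h, hx, h]
  · have : i.val = 0 := by omega
    simp [chainRow, chainRowList, this, hx, h]

lemma chainRow_none (X : Fin N → Bool) (x : Site N) (i : Fin 2)
    (h₀ : ¬(i.val = 0 ∧ x.2.val < N)) (h₁ : ¬(0 < x.2.val ∧ (i.val = 1 ↔ x.2.val < N))) :
    chainRow N X x i = (x, 0) := by
  by_cases h : x.2.val < N
  · have hi : i.val = 1 := by omega
    have h2 : x.2.val = 0 := by omega
    rw [h2] at h
    simp [chainRow, chainRowList, hi, h2, h]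
  · by_cases h2 : 0 < x.2.val
    · have hi : i.val = 1 := by omega
      simp [chainRow, chainRowList, h, h2, hi]
    · simp [chainRow, chainRowList, h, h2]

lemma bit_dependsOn (l : ℕ) :
    ∃ T : Finset (Fin N), T.card ≤ 1 ∧ DependsOn (fun X : Fin N → Bool => bit X l) T := by
  by_cases h : l < N
  · exact ⟨{⟨l, h⟩}, by simp, fun X Y hXY => by simpa [bit, h] using hXY⟩
  · exact ⟨∅, by simp, fun X Y _ => by simp [bit, h]⟩

/-- Each row entry is determined by the single bit on the link that it crosses. -/
lemma chainRow_dependsOn (x : Site N) (i : Fin 2) :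
    ∃ T : Finset (Fin N), T.card ≤ 1 ∧
      DependsOn (fun X : Fin N → Bool => chainRow N X x i) T := by
  by_cases h₀ : i.val = 0 ∧ x.2.val < N
  · obtain ⟨T, hT, h⟩ := bit_dependsOn (N := N) x.2.val
    refine ⟨T, hT, fun X Y hXY => ?_⟩
    have := h hXY
    simp only at this
    simp only [chainRow_forward _ x i h₀.1 h₀.2, this]
  by_cases h₁ : 0 < x.2.val ∧ (i.val = 1 ↔ x.2.val < N)
  · obtain ⟨T, hT, h⟩ := bit_dependsOn (N := N) (x.2.val - 1)
    refine ⟨T, hT, fun X Y hXY => ?_⟩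
    have := h hXY
    simp only at this
    simp only [chainRow_backward _ x i h₁.1 h₁.2, this]
  · exact ⟨∅, by simp, fun X Y _ => by simp only [chainRow_none _ x i h₀ h₁]⟩

lemma weight_pos {j : ℕ} (hj : j < N) : 0 < weight N j := by
  have : (j : ℝ) < N := by exact_mod_cast hj
  have : 0 < ((N : ℝ) - j) * (j + 1) := mul_pos (by linarith) (by positivity)
  unfold weight
  positivity

lemma weight_nonneg (N j : ℕ) : 0 ≤ weight N j := by
  unfold weight; positivity

lemma chainH_isHermitian (X : Fin N → Bool) : (chainH N X).IsHermitian := by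
  ext ⟨k, j⟩ ⟨k', j'⟩
  simp only [Matrix.conjTranspose_apply, chainH, Bool.xor_comm k' k]
  split_ifs <;> first | omega | simp

lemma chainH_ne_zero {X : Fin N → Bool} {x y : Site N} (h : chainH N X x y ≠ 0) :
    (y.2.val = x.2.val + 1 ∧ y.1 = xor x.1 (bit X x.2.val)) ∨
      (x.2.val = y.2.val + 1 ∧ y.1 = xor x.1 (bit X y.2.val)) := by
  unfold chainH at h
  split_ifs at h with h₁ h₂
  · exact Or.inl ⟨h₁.1, by rw [← h₁.2]; simp⟩
  · exact Or.inr ⟨h₂.1, by rw [← h₂.2]; simp⟩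
  · exact absurd rfl h

lemma chainH_forward (X : Fin N → Bool) (k : Bool) (j : ℕ) (hj : j < N) :
    chainH N X (k, ⟨j, by omega⟩) (xor k (bit X j), ⟨j + 1, by omega⟩) = weight N j := by
  simp [chainH]

lemma chainH_backward (X : Fin N → Bool) (k : Bool) (j : ℕ) (hj : j < N) :
    chainH N X (k, ⟨j + 1, by omega⟩) (xor k (bit X j), ⟨j, by omega⟩) = weight N j := by
  simp [chainH]
  intro h
  omega

lemma chainRow_isRowOracle (X : Fin N → Bool) : IsRowOracle (chainH N X) (chainRow N X) := by
  rintro ⟨k, j, hj⟩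
  have fwd := chainRow_forward X (k, ⟨j, hj⟩)
  have bwd := chainRow_backward X (k, ⟨j, hj⟩)
  have non := chainRow_none X (k, ⟨j, hj⟩)
  simp only at fwd bwd non
  rcases Nat.eq_zero_or_pos j with hj0 | hj0
  · subst hj0
    by_cases hN : 0 < N
    · refine ⟨1, by omega, ?_, ?_, ?_, ?_⟩
      · intro i hi i' hi' _
        simp only [Set.mem_ofPred_eq] at hi hi'
        omega
      · intro i hi
        rw [fwd i (by omega) hN]
        simp only
        rw [chainH_forward X k 0 hN]
        exact ⟨by exact_mod_cast (weight_pos hN).ne', rfl⟩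
      · rintro ⟨k', j', hj'⟩ hy
        refine ⟨0, by simp, ?_⟩
        rw [fwd 0 rfl hN]
        rcases chainH_ne_zero hy with ⟨h, h'⟩ | ⟨h, h'⟩
        · simp only at h h'
          simp [h, h']
        · simp at h
      · intro i hi
        exact non i (by omega) (by omega)
    · refine ⟨0, by omega, by simp [Set.InjOn], by simp, ?_, fun i _ => non i (by omega) (by omega)⟩
      rintro ⟨k', j', hj'⟩ hy
      rcases chainH_ne_zero hy with ⟨h, h'⟩ | ⟨h, h'⟩ <;> simp only at h <;> omega
  · obtain ⟨l, rfl⟩ : ∃ l, j = l + 1 := ⟨j - 1, by omega⟩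
    have hl : l < N := by omega
    by_cases hN : l + 1 < N
    · refine ⟨2, le_rfl, ?_, ?_, ?_, fun i hi => by omega⟩
      · intro i _ i' _ h
        have f0 := fwd 0 rfl hN
        have f1 := bwd 1 hj0 (by simp [hN])
        fin_cases i <;> fin_cases i' <;> simp [f0, f1] at h ⊢
        all_goals omega
      · intro i _
        rcases Nat.eq_zero_or_pos i.val with hi | hi
        · rw [fwd i hi hN]
          simp only
          rw [chainH_forward X k (l + 1) hN]
          exact ⟨by exact_mod_cast (weight_pos hN).ne', rfl⟩
        · rw [bwd i hj0 (by omega)]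
          simp only [Nat.add_sub_cancel]
          rw [chainH_backward X k l hl]
          exact ⟨by exact_mod_cast (weight_pos hl).ne', rfl⟩
      · rintro ⟨k', j', hj'⟩ hy
        rcases chainH_ne_zero hy with ⟨h, h'⟩ | ⟨h, h'⟩ <;> simp only at h h'
        · refine ⟨0, by simp, ?_⟩
          rw [fwd 0 rfl hN]
          simp [h, h']
        · refine ⟨1, by simp, ?_⟩
          rw [bwd 1 hj0 (by omega)]
          obtain rfl : l = j' := by omega
          simp [h']
    · refine ⟨1, by omega, ?_, ?_, ?_, ?_⟩
      · intro i hi i' hi' _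
        simp only [Set.mem_ofPred_eq] at hi hi'
        omega
      · intro i hi
        rw [bwd i hj0 (by omega)]
        simp only [Nat.add_sub_cancel]
        rw [chainH_backward X k l hl]
        exact ⟨by exact_mod_cast (weight_pos hl).ne', rfl⟩
      · rintro ⟨k', j', hj'⟩ hy
        refine ⟨0, by simp, ?_⟩
        rw [bwd 0 hj0 (by omega)]
        rcases chainH_ne_zero hy with ⟨h, h'⟩ | ⟨h, h'⟩ <;> simp only at h h'
        · omega
        · obtain rfl : l = j' := by omega
          simp [h']
      · intro i hi
        exact non i (by omega) (by omega)

lemma IsRowOracle.isSparse {S : Type} {d : ℕ} {H : Matrix S S ℂ} {f : S → Fin d → S × ℂ}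
    (hf : IsRowOracle H f) (hH : H.IsHermitian) : IsSparse d H := by
  have key : ∀ x, {y | H x y ≠ 0}.encard ≤ d := fun x => by
    obtain ⟨m, -, -, -, h, -⟩ := hf x
    calc {y | H x y ≠ 0}.encard ≤ ((fun i => (f x i).1) '' Set.univ).encard :=
          Set.encard_le_encard fun y hy => by
            obtain ⟨i, -, hi⟩ := h y hy
            exact ⟨i, trivial, hi⟩
      _ ≤ (Set.univ : Set (Fin d)).encard := Set.encard_image_le _ _
      _ = d := by simp
  refine fun x => ⟨key x, ?_⟩
  have : {y | H y x ≠ 0} = {y | H x y ≠ 0} := by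
    ext y
    rw [Set.mem_ofPred_eq, Set.mem_ofPred_eq, ← hH.apply x y]
    simp
  rw [this]
  exact key x

/-! ### Action of the Hamiltonian and its norm -/

/-- The action on a vector, written for amplitudes given on all natural positions: since
`weight N N = 0`, no boundary condition at `j = N` is needed. -/
lemma chainH_mulVec (X : Fin N → Bool) (g : Bool → ℕ → ℂ) (x : Site N) :
    (chainH N X).mulVec (fun y => g y.1 y.2.val) x =
      weight N x.2.val * g (xor x.1 (bit X x.2.val)) (x.2.val + 1) +
      if 0 < x.2.val then
        weight N (x.2.val - 1) * g (xor x.1 (bit X (x.2.val - 1))) (x.2.val - 1) else 0 := by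
  obtain ⟨k, j, hj⟩ := x
  have split : ∀ y : Site N, chainH N X (k, ⟨j, hj⟩) y * g y.1 y.2.val =
      (if y.2.val = j + 1 ∧ xor k y.1 = bit X j then
        weight N j * g (xor k (bit X j)) (j + 1) else 0) +
      (if j = y.2.val + 1 ∧ xor k y.1 = bit X (j - 1) then
        weight N (j - 1) * g (xor k (bit X (j - 1))) (j - 1) else 0) := by
    rintro ⟨k', j', hj'⟩
    simp only [chainH]
    by_cases h2 : j = j' + 1
    · subst h2
      have h3 : ¬ j' = j' + 1 + 1 := by omega
      simp only [Nat.add_sub_cancel, h3, false_and, if_false, zero_add, true_and]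
      by_cases h4 : xor k k' = bit X j'
      · rw [if_pos h4, if_pos h4, ← h4]; simp
      · rw [if_neg h4, if_neg h4, zero_mul]
    · simp only [h2, false_and, if_false, add_zero]
      by_cases h1 : j' = j + 1 ∧ xor k k' = bit X j
      · rw [if_pos h1, if_pos h1, ← h1.2, h1.1]; simp
      · rw [if_neg h1, if_neg h1, zero_mul]
  simp only [Matrix.mulVec, dotProduct, split, Finset.sum_add_distrib]
  congr 1
  · by_cases h : j < N
    · rw [Finset.sum_eq_single ((xor k (bit X j), ⟨j + 1, by omega⟩) : Site N)]
      · simp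
      · rintro ⟨k', j', hj'⟩ _ hne
        rw [if_neg]
        rintro ⟨h1, h2⟩
        simp only at h1 h2
        exact hne (by simp [h1, ← h2])
      · simp
    · have : weight N j = 0 := by
        have : j = N := by omega
        simp [weight, this]
      simp [this]
  · by_cases h : 0 < j
    · rw [Finset.sum_eq_single ((xor k (bit X (j - 1)), ⟨j - 1, by omega⟩) : Site N)]
      · simp [h]
        intro h'
        omega
      · rintro ⟨k', j', hj'⟩ _ hne
        rw [if_neg]
        rintro ⟨h1, h2⟩
        simp only at h1 h2
        subst h1
        rw [Nat.add_sub_cancel] at h2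
        exact hne (by simp [← h2])
      · simp
    · have : j = 0 := by omega
      simp [this]

lemma weight_mul_sqrt_choose_succ {j : ℕ} (hj : j ≤ N) :
    weight N j * √(N.choose (j + 1)) = ((N : ℝ) - j) / 2 * √(N.choose j) := by
  have hj' : (j : ℝ) ≤ N := by exact_mod_cast hj
  have h : (N.choose (j + 1) : ℝ) * (j + 1) = N.choose j * (N - j) := by
    have := Nat.choose_succ_right_eq N j
    rw [← Nat.cast_sub hj]
    exact_mod_cast this
  have h1 : √((N - j) * (j + 1)) * √(N.choose (j + 1)) = (N - j) * √(N.choose j) := by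
    rw [← Real.sqrt_mul (mul_nonneg (by linarith) (by positivity)), mul_assoc,
      mul_comm (_ + 1 : ℝ), h, mul_left_comm, Real.sqrt_mul (by positivity), Real.sqrt_mul_self (by linarith), mul_comm]
  rw [weight]
  linear_combination h1 / 2

lemma weight_mul_sqrt_choose {j : ℕ} (hj : j < N) :
    weight N j * √(N.choose j) = ((j : ℝ) + 1) / 2 * √(N.choose (j + 1)) := by
  have hj' : (j : ℝ) < N := by exact_mod_cast hj
  have h : (N.choose (j + 1) : ℝ) * (j + 1) = N.choose j * (N - j) := by
    have := Nat.choose_succ_right_eq N j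
    rw [← Nat.cast_sub hj.le]
    exact_mod_cast this
  have h1 : √((N - j) * (j + 1)) * √(N.choose j) = (j + 1) * √(N.choose (j + 1)) := by
    rw [← Real.sqrt_mul (mul_nonneg (by linarith) (by positivity))]
    have : ((N : ℝ) - j) * (j + 1) * N.choose j = (j + 1) * (j + 1) * N.choose (j + 1) := by
      linear_combination (-(j : ℝ) - 1) * h
    rw [this, Real.sqrt_mul (by positivity), Real.sqrt_mul_self (by positivity)]
  rw [weight]
  linear_combination h1 / 2

/-- Schur test: if `|H| p = c p` for a positive vector `p`, where `|H|` holds the absolute values of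
the entries of a Hermitian matrix `H`, then `‖H‖ ≤ c`. -/
lemma norm_toEuclideanCLM_le {S : Type} [Fintype S] [DecidableEq S] (H : Matrix S S ℂ)
    (hH : H.IsHermitian) (p : S → ℝ) (hp : ∀ x, 0 < p x) (c : ℝ) (hc : 0 ≤ c)
    (hHp : ∀ x, ∑ y, ‖H x y‖ * p y = c * p x) :
    ‖Matrix.toEuclideanCLM (𝕜 := ℂ) H‖ ≤ c := by
  have hsymm : ∀ x y, ‖H x y‖ = ‖H y x‖ := fun x y => by rw [← hH.apply x y, norm_star]
  refine ContinuousLinearMap.opNorm_le_bound _ hc fun v => ?_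
  refine abs_le_of_sq_le_sq' ?_ (by positivity) |>.2
  rw [mul_pow, EuclideanSpace.norm_sq_eq, EuclideanSpace.norm_sq_eq]
  have row : ∀ x, ‖Matrix.toEuclideanCLM (𝕜 := ℂ) H v x‖ ^ 2 ≤
      (c * p x) * ∑ y, ‖H x y‖ * ‖v y‖ ^ 2 / p y := fun x => by
    calc ‖Matrix.toEuclideanCLM (𝕜 := ℂ) H v x‖ ^ 2 ≤ (∑ y, ‖H x y‖ * ‖v y‖) ^ 2 := by
          gcongr
          rw [Matrix.ofLp_toEuclideanCLM, Matrix.mulVec, dotProduct]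
          refine (norm_sum_le _ _).trans_eq ?_
          simp
      _ ≤ (∑ y, ‖H x y‖ * p y) * ∑ y, ‖H x y‖ * ‖v y‖ ^ 2 / p y := by
          refine Finset.sum_sq_le_sum_mul_sum_of_sq_le_mul _
            (fun y _ => mul_nonneg (norm_nonneg _) (hp y).le)
            (fun y _ => div_nonneg (by positivity) (hp y).le) fun y _ => ?_
          have := (hp y).ne'
          apply le_of_eq
          field_simp
      _ = _ := by rw [hHp]
  refine (Finset.sum_le_sum fun x _ => row x).trans_eq ?_
  simp only [Finset.mul_sum]
  rw [Finset.sum_comm]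
  refine Finset.sum_congr rfl fun y _ => ?_
  have := (hp y).ne'
  calc ∑ x, c * p x * (‖H x y‖ * ‖v y‖ ^ 2 / p y) =
        c * (‖v y‖ ^ 2 / p y) * ∑ x, ‖H y x‖ * p x := by
        rw [Finset.mul_sum]
        exact Finset.sum_congr rfl fun x _ => by rw [hsymm x y]; ring
    _ = c ^ 2 * ‖v y‖ ^ 2 := by rw [hHp]; field_simp

/-- On either line, `√(N choose j)` is the top eigenvector of the spin operator `J_x`; it does not
depend on `k`, so the crossings do not matter. -/
lemma chainH_mulVec_sqrt_choose (X : Fin N → Bool) (x : Site N) :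
    (chainH N X).mulVec (fun y => ((√(N.choose y.2.val) : ℝ) : ℂ)) x =
      ((N / 2 * √(N.choose x.2.val) : ℝ) : ℂ) := by
  rw [chainH_mulVec X (fun _ j => ((√(N.choose j) : ℝ) : ℂ))]
  obtain ⟨k, j, hj⟩ := x
  have h1 := weight_mul_sqrt_choose_succ (N := N) (j := j) (by omega)
  rcases Nat.eq_zero_or_pos j with rfl | h0
  · simp only [lt_irrefl, if_false, add_zero]
    rw [← Complex.ofReal_mul, h1]
    simp
  · obtain ⟨l, rfl⟩ : ∃ l, j = l + 1 := ⟨j - 1, by omega⟩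
    have h2 := weight_mul_sqrt_choose (N := N) (j := l) (by omega)
    simp only [h0, if_true, Nat.add_sub_cancel]
    rw [← Complex.ofReal_mul, ← Complex.ofReal_mul, h1, h2, ← Complex.ofReal_add]
    congr 1
    push_cast
    ring

lemma norm_chainH_apply (X : Fin N → Bool) (x y : Site N) :
    ((‖chainH N X x y‖ : ℝ) : ℂ) = chainH N X x y := by
  unfold chainH
  split_ifs <;> simp [abs_of_nonneg (weight_nonneg _ _)]

lemma norm_chainH (X : Fin N → Bool) : ‖Matrix.toEuclideanCLM (𝕜 := ℂ) (chainH N X)‖ = N / 2 := by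
  set p : Site N → ℝ := fun y => √(N.choose y.2.val)
  have hp : ∀ x, 0 < p x := fun x =>
    Real.sqrt_pos.2 (by exact_mod_cast Nat.choose_pos (by omega))
  have hc : (0 : ℝ) ≤ N / 2 := by positivity
  apply le_antisymm
  · refine norm_toEuclideanCLM_le _ (chainH_isHermitian X) p hp _ hc fun x => ?_
    have h := chainH_mulVec_sqrt_choose X x
    simp only [Matrix.mulVec, dotProduct] at h
    have e : ((∑ y, ‖chainH N X x y‖ * p y : ℝ) : ℂ) =
        ∑ y, chainH N X x y * ((√(N.choose y.2.val) : ℝ) : ℂ) := by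
      push_cast
      simp only [norm_chainH_apply, p]
    rw [← e] at h
    exact_mod_cast h
  · set v : EuclideanSpace ℂ (Site N) := WithLp.toLp 2 (fun y => ((p y : ℝ) : ℂ))
    have hv : v ≠ 0 := fun h => by
      have := congrArg (fun w : EuclideanSpace ℂ (Site N) => w (false, 0)) h
      simp [v, (hp _).ne'] at this
    have hHv : Matrix.toEuclideanCLM (𝕜 := ℂ) (chainH N X) v = ((N / 2 : ℝ) : ℂ) • v := by
      ext x
      rw [Matrix.ofLp_toEuclideanCLM]
      have h := chainH_mulVec_sqrt_choose X x
      simp only [v, p, PiLp.smul_apply, smul_eq_mul]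
      rw [h]
      push_cast
      rfl
    have := (Matrix.toEuclideanCLM (𝕜 := ℂ) (chainH N X)).le_opNorm v
    rw [hHv, norm_smul, Complex.norm_real, Real.norm_of_nonneg hc] at this
    exact le_of_mul_le_mul_right this (norm_pos_iff.2 hv)

end Chain

/-! ### Time evolution along the chain -/

open scoped Matrix.Norms.Operator in
/-- A solution of the linear system `v' = A v` is given by the matrix exponential, because
`exp(-z A) v(z)` has derivative zero. -/
lemma exp_smul_mulVec_eq {S : Type} [Fintype S] [DecidableEq S] (A : Matrix S S ℂ)
    (v : ℂ → S → ℂ) (hv : ∀ z x, HasDerivAt (fun z => v z x) (A.mulVec (v z) x) z) (z : ℂ) :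
    (NormedSpace.exp (z • A)).mulVec (v 0) = v z := by
  have hexp : ∀ z : ℂ, HasDerivAt (fun u : ℂ => NormedSpace.exp (u • (-A)))
      (NormedSpace.exp (z • (-A)) * (-A)) z := fun z => hasDerivAt_exp_smul_const (-A) z
  have hent : ∀ z x y, HasDerivAt (fun u : ℂ => NormedSpace.exp (u • (-A)) x y)
      ((NormedSpace.exp (z • (-A)) * (-A)) x y) z := fun z x y =>
    ((Matrix.entryLinearMap ℂ ℂ x y).toContinuousLinearMap.hasFDerivAt).comp_hasDerivAt z (hexp z)
  have hconst : ∀ x, (NormedSpace.exp (z • (-A))).mulVec (v z) x = v 0 x := fun x => by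
    have hd : ∀ z, HasDerivAt (fun u => (NormedSpace.exp (u • (-A))).mulVec (v u) x) 0 z := by
      intro z
      have h := HasDerivAt.fun_sum (u := Finset.univ) fun y _ => (hent z x y).mul (hv z y)
      simp only [Matrix.mulVec, dotProduct] at h ⊢
      refine h.congr_deriv ?_
      have e : (NormedSpace.exp (z • (-A))).mulVec (A.mulVec (v z)) x =
          (NormedSpace.exp (z • (-A)) * A).mulVec (v z) x := by
        rw [Matrix.mulVec_mulVec]
      simp only [Matrix.mulVec, dotProduct] at e
      rw [Finset.sum_add_distrib, e]
      simp
    have := is_const_of_deriv_eq_zero (fun u => (hd u).differentiableAt)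
      (fun u => (hd u).deriv) z 0
    simpa using this
  rw [← funext hconst, Matrix.mulVec_mulVec, smul_neg,
    ← Matrix.exp_add_of_commute _ _ (Commute.refl (z • A)).neg_right]
  simp

section Evolution

variable {N : ℕ}

/-- The line reached at position `j` by a walker that starts on line `0`: the parity of the first
`j` bits. -/
def lineAt (X : Fin N → Bool) : ℕ → Bool
  | 0 => false
  | j + 1 => xor (lineAt X j) (bit X j)

/-- The amplitude at position `j` at time `z` of the `J_x` rotation of the state at position `0`,
a spin coherent state. -/
noncomputable def coherentAmp (N : ℕ) (z : ℂ) (j : ℕ) : ℂ :=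
  (√(N.choose j) : ℝ) * Complex.cos (z / 2) ^ (N - j) *
    (-Complex.I * Complex.sin (z / 2)) ^ j

lemma hasDerivAt_coherentAmp {j : ℕ} (hj : j ≤ N) (z : ℂ) :
    HasDerivAt (fun z => coherentAmp N z j)
      (-Complex.I * (weight N j * coherentAmp N z (j + 1) +
        if 0 < j then weight N (j - 1) * coherentAmp N z (j - 1) else 0)) z := by
  have hhalf : HasDerivAt (fun z : ℂ => z / 2) (1 / 2) z := (hasDerivAt_id z).div_const 2
  have hc := (hhalf.ccos.pow (N - j)).const_mul ((√(N.choose j) : ℝ) : ℂ)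
  have hs := (hhalf.csin.const_mul (-Complex.I)).pow j
  refine (hc.mul hs).congr_deriv ?_
  have h1 : (weight N j : ℂ) * (√(N.choose (j + 1)) : ℝ) =
      ((N - j : ℕ) : ℂ) / 2 * (√(N.choose j) : ℝ) := by
    have := weight_mul_sqrt_choose_succ hj
    rw [← Nat.cast_sub hj] at this
    rw [← Complex.ofReal_mul, this]
    simp
  have e1 : (weight N j : ℂ) * coherentAmp N z (j + 1) =
      ((N - j : ℕ) : ℂ) / 2 * (√(N.choose j) : ℝ) * Complex.cos (z / 2) ^ (N - j - 1) *
        (-Complex.I * Complex.sin (z / 2)) ^ (j + 1) := by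
    rw [coherentAmp, ← mul_assoc, ← mul_assoc, h1, Nat.sub_sub]
  rw [e1]
  have hI := Complex.I_sq
  rcases Nat.eq_zero_or_pos j with rfl | h0
  · simp
    linear_combination (-(N : ℂ) / 2 * Complex.cos (z / 2) ^ (N - 1) * Complex.sin (z / 2)) * hI
  · obtain ⟨l, rfl⟩ : ∃ l, j = l + 1 := ⟨j - 1, by omega⟩
    have h2 : (weight N l : ℂ) * (√(N.choose l) : ℝ) =
        ((l : ℂ) + 1) / 2 * (√(N.choose (l + 1)) : ℝ) := by
      have := weight_mul_sqrt_choose (N := N) (j := l) (by omega)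
      rw [← Complex.ofReal_mul, this]
      simp
    have e2 : (weight N l : ℂ) * coherentAmp N z l =
        ((l : ℂ) + 1) / 2 * (√(N.choose (l + 1)) : ℝ) * Complex.cos (z / 2) ^ (N - l) *
          (-Complex.I * Complex.sin (z / 2)) ^ l := by
      rw [coherentAmp, ← mul_assoc, ← mul_assoc, h2]
    simp only [h0, if_true, Nat.add_sub_cancel]
    rw [e2, show N - l = N - (l + 1) + 1 by omega]
    push_cast
    simp only [Pi.pow_apply]
    linear_combination ((√(N.choose (l + 1)) : ℝ) * ((N - (l + 1) : ℕ) : ℂ) / 2 *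
      Complex.cos (z / 2) ^ (N - (l + 1) - 1) * (-Complex.I * Complex.sin (z / 2)) ^ (l + 1) *
      (-Complex.sin (z / 2))) * hI

/-- The state at time `t` started from position `0` on line `0`: the coherent state, on the line
that the crossings prescribe at each position. -/
lemma exp_chainH_mulVec (X : Fin N → Bool) (t : ℂ) :
    (NormedSpace.exp ((-(Complex.I * t)) • chainH N X)).mulVec
        (fun x => if x.1 = false ∧ x.2.val = 0 then 1 else 0) =
      fun x => if x.1 = lineAt X x.2.val then coherentAmp N t x.2.val else 0 := by
  set v : ℂ → Site N → ℂ :=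
    fun z x => if x.1 = lineAt X x.2.val then coherentAmp N z x.2.val else 0 with hvdef
  have hv : ∀ z x, HasDerivAt (fun z => v z x)
      (((-Complex.I) • chainH N X).mulVec (v z) x) z := by
    rintro z ⟨k, j, hj⟩
    have h := chainH_mulVec X (fun k j => if k = lineAt X j then coherentAmp N z j else 0)
      (k, ⟨j, hj⟩)
    rw [Matrix.smul_mulVec, Pi.smul_apply]
    rw [show (chainH N X).mulVec (v z) (k, ⟨j, hj⟩) = _ from h]
    simp only [hvdef, smul_eq_mul]
    have c1 : xor k (bit X j) = lineAt X (j + 1) ↔ k = lineAt X j := by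
      simp [lineAt]
    have c2 : 0 < j → (xor k (bit X (j - 1)) = lineAt X (j - 1) ↔ k = lineAt X j) := by
      intro h0
      obtain ⟨l, rfl⟩ : ∃ l, j = l + 1 := ⟨j - 1, by omega⟩
      simp only [Nat.add_sub_cancel, lineAt]
      cases k <;> cases bit X l <;> cases lineAt X l <;> simp
    by_cases hk : k = lineAt X j
    · simp only [if_pos hk]
      refine (hasDerivAt_coherentAmp (N := N) (j := j) (by omega) z).congr_deriv ?_
      · rw [if_pos (c1.2 hk)]
        by_cases h0 : 0 < j
        · simp only [h0, if_true, if_pos ((c2 h0).2 hk)]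
        · simp only [h0, if_false]
    · simp only [if_neg hk]
      refine (hasDerivAt_const z (0 : ℂ)).congr_deriv ?_
      · rw [if_neg (mt c1.1 hk)]
        by_cases h0 : 0 < j
        · simp only [h0, if_true, if_neg (mt (c2 h0).1 hk)]
          simp
        · simp [h0]
  have h0 : v 0 = fun x => if x.1 = false ∧ x.2.val = 0 then 1 else 0 := by
    funext ⟨k, j, hj⟩
    rcases Nat.eq_zero_or_pos j with rfl | hpos
    · simp [hvdef, coherentAmp, lineAt]
    · simp [hvdef, coherentAmp, hpos.ne']
  have := exp_smul_mulVec_eq _ v hv t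
  rw [smul_smul, h0] at this
  rw [show -(Complex.I * t) = t * -Complex.I by ring]
  exact this

/-- At time `π` the walker is at the far end, on the line given by the parity of `X`. -/
lemma exp_pi_chainH_mulVec (X : Fin N → Bool) :
    (NormedSpace.exp ((-(Complex.I * (Real.pi : ℝ))) • chainH N X)).mulVec
        (fun x => if x.1 = false ∧ x.2.val = 0 then 1 else 0) =
      fun x => if x.1 = lineAt X N ∧ x.2.val = N then (-Complex.I) ^ N else 0 := by
  rw [exp_chainH_mulVec]
  funext ⟨k, j, hj⟩
  by_cases h : j = N
  · subst h
    simp [coherentAmp]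
  · have : N - j ≠ 0 := by omega
    simp [coherentAmp, h, this]

lemma prod_range_sign_eq (X : Fin N → Bool) (j : ℕ) :
    ∏ i ∈ Finset.range j, (if bit X i then (-1 : ℂ) else 1) = if lineAt X j then -1 else 1 := by
  induction j with
  | zero => simp [lineAt]
  | succ j ih =>
    rw [Finset.prod_range_succ, ih, lineAt]
    cases lineAt X j <;> cases bit X j <;> simp

lemma paritySign_eq (X : Fin N → Bool) : paritySign X = if lineAt X N then -1 else 1 := by
  rw [← prod_range_sign_eq, Finset.prod_range, paritySign]
  exact Finset.prod_congr rfl fun i _ => by simp [bit]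

/-! ### The query lower bound -/

/-- The observable that is `1` at the end of line `0`, `-1` at the end of line `1` and zero
elsewhere. -/
def endSign (x : Site N) : ℂ := if x.2.val = N then (if x.1 then -1 else 1) else 0

lemma norm_endSign_le (x : Site N) : ‖endSign x‖ ≤ 1 := by
  unfold endSign; split_ifs <;> simp

/-- The expectation value of `endSign` in the output approximates the parity sign to within `1/2`
and has degree at most twice the number of queries, so that this degree must be at least `N`. -/
lemma le_two_mul_queries {b : ℕ} (enc : Site N × ℂ → Fin b → Bool) (A : QueryAlg (Site N) 2 b)
    (hA : ∀ X : Fin N → Bool, A.Simulates enc (chainRow N X) (chainH N X) Real.pi (1 / 4)) :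
    N ≤ 2 * A.queries := by
  by_contra! hlt
  set ψ : Site N → ℂ := fun x => if x.1 = false ∧ x.2.val = 0 then 1 else 0 with hψ
  have hψ1 : ∑ s, ‖ψ s‖ ^ 2 = 1 := by
    rw [Finset.sum_eq_single ((false, 0) : Site N)]
    · simp [ψ]
    · rintro ⟨k, j⟩ _ hne
      have : ¬ (k = false ∧ j.val = 0) := fun h => hne (by
        ext <;> simp [h.1, h.2])
      simp only [ψ, if_neg this]
      simp
    · simp
  set q : (Fin N → Bool) → ℂ := fun X => ∑ s, endSign s * A.output enc (chainRow N X) ψ s s with hq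
  have hdeg : q ∈ degLE (Fin N) (2 * A.queries) := by
    have : q = ∑ s, endSign s • (fun X => A.output enc (chainRow N X) ψ s s) := by
      funext X
      simp [hq, Finset.sum_apply]
    rw [this]
    exact Submodule.sum_mem _ fun s _ => Submodule.smul_mem _ _
      (output_mem_degLE A enc _ chainRow_dependsOn ψ s s)
  have hclose : ∀ X, ‖q X - paritySign X‖ ≤ 1 / 2 := fun X => by
    have h := (norm_sum_mul_diag_sub_le_traceDist (A.output enc (chainRow N X) ψ)
      (pureState (Matrix.mulVec
        (NormedSpace.exp ((-(Complex.I * (Real.pi : ℂ))) • chainH N X)) ψ))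
      endSign norm_endSign_le).trans
        (mul_le_mul_of_nonneg_left (hA X ψ hψ1) zero_le_two)
    rw [hψ, exp_pi_chainH_mulVec, ← hψ] at h
    have e : ∑ s, endSign s * pureState
        (fun x : Site N => if x.1 = lineAt X N ∧ x.2.val = N then (-Complex.I) ^ N else 0) s s =
        paritySign X := by
      rw [Finset.sum_eq_single ((lineAt X N, Fin.last N) : Site N)]
      · have : (-Complex.I) ^ N * star ((-Complex.I) ^ N) = 1 := by
          rw [star_pow, ← mul_pow]
          simp
        rw [pureState, Matrix.vecMulVec_apply, paritySign_eq]
        simp only [Pi.star_apply, Fin.val_last, and_self, if_true, this, mul_one]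
        simp [endSign]
      · rintro ⟨k, j⟩ _ hne
        have : ¬ (k = lineAt X N ∧ j.val = N) := fun h => hne (by
          ext <;> simp [h.1, h.2])
        simp only [pureState, Matrix.vecMulVec_apply, if_neg this]
        simp
      · simp
    rw [e] at h
    exact h.trans_eq (by norm_num)
  have horth := sum_paritySign_mul_eq_zero (by simpa using hlt) hdeg
  have hsum : ∑ X, paritySign X * (q X - paritySign X) =
      -(Fintype.card (Fin N → Bool) : ℂ) := by
    simp only [mul_sub, Finset.sum_sub_distrib, horth, paritySign_mul_self]
    simp
  have hbound : ‖∑ X, paritySign X * (q X - paritySign X)‖ ≤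
      ∑ _X : Fin N → Bool, (1 / 2 : ℝ) := by
    refine (norm_sum_le _ _).trans (Finset.sum_le_sum fun X _ => ?_)
    have : ‖paritySign X‖ = 1 := by
      rw [paritySign_eq]; split_ifs <;> simp
    rw [norm_mul, this, one_mul]
    exact hclose X
  rw [hsum, norm_neg, Complex.norm_natCast, Finset.sum_const, Finset.card_univ, nsmul_eq_mul]
    at hbound
  have : (0 : ℝ) < Fintype.card (Fin N → Bool) := by exact_mod_cast Fintype.card_pos
  linarith

end Evolution

/-! ### Programs without loops and a rule for loops -/

/-- The final registers of a loop-free program. Loops are skipped. -/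
def Prog.eval (X : ℕ → Bool) : Prog → (ℕ → ℕ) → ℕ → ℕ
  | .const r c, s => Function.update s r c
  | .add r a b, s => Function.update s r (s a + s b)
  | .sub r a b, s => Function.update s r (s a - s b)
  | .mul r a b, s => Function.update s r (s a * s b)
  | .div r a b, s => Function.update s r (s a / s b)
  | .read r a, s => Function.update s r (X (s a)).toNat
  | .seq p q, s => q.eval X (p.eval X s)
  | .ite a p q, s => if s a ≠ 0 then p.eval X s else q.eval X s
  | .loop _ _, s => s

/-- The cost of a loop-free program. Loops are skipped. -/
def Prog.cost (X : ℕ → Bool) : Prog → (ℕ → ℕ) → ℕ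
  | .const _ c, _ => 1 + c.size
  | .add _ a b, s => 1 + (s a).size + (s b).size
  | .sub _ a b, s => 1 + (s a).size + (s b).size
  | .mul _ a b, s => 1 + (s a).size + (s b).size
  | .div _ a b, s => 1 + (s a).size + (s b).size
  | .read _ a, s => 1 + (s a).size
  | .seq p q, s => p.cost X s + q.cost X (p.eval X s)
  | .ite a p q, s => 1 + (s a).size + if s a ≠ 0 then p.cost X s else q.cost X s
  | .loop _ _, _ => 0

/-- The program contains no loop. -/
def Prog.LoopFree : Prog → Prop
  | .seq p q => p.LoopFree ∧ q.LoopFree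
  | .ite _ p q => p.LoopFree ∧ q.LoopFree
  | .loop _ _ => False
  | _ => True

lemma Prog.LoopFree.exec {X : ℕ → Bool} {P : Prog} (hP : P.LoopFree) (s : ℕ → ℕ) :
    Exec X P s (P.eval X s) (P.cost X s) := by
  induction P generalizing s with
  | const r c => exact .const r c s
  | add r a b => exact .add r a b s
  | sub r a b => exact .sub r a b s
  | mul r a b => exact .mul r a b s
  | div r a b => exact .div r a b s
  | read r a => exact .read r a s
  | seq p q hp hq => exact .seq p q _ _ _ _ _ (hp hP.1 s) (hq hP.2 _)
  | ite a p q hp hq =>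
    by_cases h : s a = 0
    · simpa [Prog.eval, Prog.cost, h] using Exec.iteFalse (X := X) a p q s _ _ h (hq hP.2 s)
    · simpa [Prog.eval, Prog.cost, h] using Exec.iteTrue (X := X) a p q s _ _ h (hp hP.1 s)
  | loop a p => exact hP.elim

/-- `K` bounds the growth factor of the register lengths and the cost per bit of register length
of a loop-free program. -/
def Prog.GrowthBound (P : Prog) (K : ℕ) : Prop :=
  1 ≤ K ∧ ∀ (X : ℕ → Bool) (B : ℕ) (s : ℕ → ℕ), 1 ≤ B → (∀ r, s r < 2 ^ B) →
    P.cost X s ≤ K * B ∧ ∀ r, P.eval X s r < 2 ^ (K * B)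

lemma update_lt {s : ℕ → ℕ} {B v M : ℕ} (hs : ∀ r, s r < 2 ^ B) (hBM : B ≤ M)
    (hv : v < 2 ^ M) (r r' : ℕ) : Function.update s r v r' < 2 ^ M := by
  rcases eq_or_ne r' r with rfl | h
  · simpa using hv
  · rw [Function.update_of_ne h]
    exact (hs r').trans_le (Nat.pow_le_pow_right two_pos hBM)

/-- Every loop-free program has a growth bound, since each instruction at most adds the lengths
of its operands and there are boundedly many instructions. -/
lemma Prog.exists_growthBound (P : Prog) : ∃ K, P.GrowthBound K := by
  have arith : ∀ (op : ℕ → ℕ → ℕ) (r a b : ℕ)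
      (_ : ∀ m n B, 1 ≤ B → m < 2 ^ B → n < 2 ^ B → op m n < 2 ^ (3 * B))
      (s : ℕ → ℕ) (B : ℕ), 1 ≤ B → (∀ r, s r < 2 ^ B) →
      1 + (s a).size + (s b).size ≤ 3 * B ∧
        ∀ r', Function.update s r (op (s a) (s b)) r' < 2 ^ (3 * B) := by
    intro op r a b hop s B hB hs
    have ha := Nat.size_le.2 (hs a)
    have hb := Nat.size_le.2 (hs b)
    exact ⟨by omega, update_lt hs (by omega) (hop _ _ B hB (hs a) (hs b)) r⟩
  have grow : ∀ B, 2 ^ B ≤ 2 ^ (3 * B) := fun B => Nat.pow_le_pow_right two_pos (by omega)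
  induction P with
  | const r c =>
    refine ⟨c + 1, by omega, fun X B s hB hs => ?_⟩
    have h1 : c + 1 ≤ (c + 1) * B := Nat.le_mul_of_pos_right _ hB
    have hc : c < 2 ^ c := Nat.lt_two_pow_self
    refine ⟨?_, update_lt hs (Nat.le_mul_of_pos_left _ (by omega))
      (hc.trans_le (Nat.pow_le_pow_right two_pos (by omega))) r⟩
    have := Nat.size_le.2 hc
    simp only [Prog.cost]
    omega
  | add r a b =>
    refine ⟨3, by omega, fun X B s hB hs => arith (· + ·) r a b (fun m n B hB hm hn => ?_) s B hB hs⟩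
    have : 2 ^ (B + 1) ≤ 2 ^ (3 * B) := Nat.pow_le_pow_right two_pos (by omega)
    rw [pow_succ] at this
    omega
  | sub r a b =>
    exact ⟨3, by omega, fun X B s hB hs => arith (· - ·) r a b (fun m n B hB hm hn =>
      ((Nat.sub_le _ _).trans_lt hm).trans_le (grow B)) s B hB hs⟩
  | mul r a b =>
    refine ⟨3, by omega, fun X B s hB hs => arith (· * ·) r a b (fun m n B hB hm hn => ?_) s B hB hs⟩
    calc m * n < 2 ^ B * 2 ^ B := Nat.mul_lt_mul'' hm hn
      _ = 2 ^ (B + B) := (pow_add _ _ _).symm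
      _ ≤ 2 ^ (3 * B) := Nat.pow_le_pow_right two_pos (by omega)
  | div r a b =>
    exact ⟨3, by omega, fun X B s hB hs => arith (· / ·) r a b (fun m n B hB hm hn =>
      ((Nat.div_le_self _ _).trans_lt hm).trans_le (grow B)) s B hB hs⟩
  | read r a =>
    refine ⟨2, by omega, fun X B s hB hs => ⟨?_, update_lt hs (by omega) ?_ r⟩⟩
    · have ha := Nat.size_le.2 (hs a)
      simp only [Prog.cost]
      omega
    · have : 2 ^ 1 ≤ 2 ^ (2 * B) := Nat.pow_le_pow_right two_pos (by omega)
      have := Bool.toNat_lt (X (s a))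
      omega
  | seq p q hp hq =>
    obtain ⟨K, hK, hp⟩ := hp
    obtain ⟨L, hL, hq⟩ := hq
    refine ⟨K + L * K, by omega, fun X B s hB hs => ?_⟩
    obtain ⟨h1, h2⟩ := hp X B s hB hs
    obtain ⟨h3, h4⟩ := hq X (K * B) _ (Nat.mul_pos hK hB) h2
    rw [← mul_assoc] at h3 h4
    refine ⟨?_, fun r => (h4 r).trans_le (Nat.pow_le_pow_right two_pos ?_)⟩
    · simp only [Prog.cost, add_mul]
      omega
    · rw [add_mul]; omega
  | ite a p q hp hq =>
    obtain ⟨K, hK, hp⟩ := hp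
    obtain ⟨L, hL, hq⟩ := hq
    refine ⟨2 + K + L, by omega, fun X B s hB hs => ?_⟩
    have ha := Nat.size_le.2 (hs a)
    obtain ⟨h1, h2⟩ := hp X B s hB hs
    obtain ⟨h3, h4⟩ := hq X B s hB hs
    simp only [Prog.cost, Prog.eval, add_mul]
    split_ifs
    · exact ⟨by omega, fun r => (h2 r).trans_le (Nat.pow_le_pow_right two_pos (by omega))⟩
    · exact ⟨by omega, fun r => (h4 r).trans_le (Nat.pow_le_pow_right two_pos (by omega))⟩
  | loop a p =>
    exact ⟨1, le_rfl, fun X B s hB hs => ⟨by simp [Prog.cost], by simpa [Prog.eval] using hs⟩⟩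

/-- Total correctness of loops with a cost bound. The index `n` of the invariant bounds the number
of remaining rounds. -/
lemma exists_exec_loop {X : ℕ → Bool} {a : ℕ} {body : Prog} (hfree : body.LoopFree) {K : ℕ}
    (hK : body.GrowthBound K) {B : ℕ} (hB : 1 ≤ B) (I : ℕ → (ℕ → ℕ) → Prop)
    (hI : ∀ n s, I n s → ∀ r, s r < 2 ^ B)
    (hstep : ∀ n s, I n s → s a ≠ 0 → ∃ n', n = n' + 1 ∧ I n' (body.eval X s))
    (n : ℕ) (s : ℕ → ℕ) (hs : I n s) :
    ∃ s' c, Exec X (.loop a body) s s' c ∧ c ≤ n * (1 + B + K * B) + 1 ∧ s' a = 0 ∧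
      ∃ n', I n' s' := by
  induction n generalizing s with
  | zero =>
    by_cases h : s a = 0
    · exact ⟨s, 1, .loopDone a body s h, by omega, h, 0, hs⟩
    · obtain ⟨n', h0, -⟩ := hstep 0 s hs h
      omega
  | succ n ih =>
    by_cases h : s a = 0
    · exact ⟨s, 1, .loopDone a body s h, by omega, h, n + 1, hs⟩
    · obtain ⟨n', h0, hs'⟩ := hstep _ s hs h
      obtain rfl : n = n' := by omega
      obtain ⟨s', c, he, hc, h1, h2⟩ := ih _ hs'
      refine ⟨s', _, .loopStep a body s _ s' _ c h (hfree.exec s) he, ?_, h1, h2⟩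
      have := (hK.2 X B s hB (hI _ s hs)).1
      have ha := Nat.size_le.2 (hI _ s hs a)
      rw [add_mul]
      omega

/-! ### The program for the rows of the crossing lines -/

/-- Moves to the link towards `j + 1`: sets the flag in register `7`, the link in `8` and the new
position in `9`. Register `5` holds one and register `21` zero. -/
def goForward : Prog :=
  .seq (.const 7 1) (.seq (.add 8 2 21) (.add 9 2 5))

/-- Moves to the link towards `j - 1` if there is one. -/
def goBackward : Prog :=
  .ite 2 (.seq (.const 7 1) (.seq (.sub 8 2 5) (.sub 9 2 5))) (.const 7 0)

/-- Finds the link `l` belonging to the index. Register `9` receives the new position, `10` the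
number `(N - l) * (l + 1)` or zero if there is no such link, and `11` the new line. -/
def findEntry : Prog :=
  .seq (.const 5 1) <| .seq (.const 19 2) <| .seq (.const 13 1) <| .seq (.sub 6 0 2) <|
  .seq (.add 9 2 21) <|
  .seq (.ite 3 (.ite 6 goBackward (.const 7 0)) (.ite 6 goForward goBackward)) <|
  .seq (.sub 10 0 8) <| .seq (.add 12 8 5) <| .seq (.mul 10 10 12) <| .seq (.mul 10 10 7) <|
  .seq (.read 11 8) <| .seq (.mul 11 11 7) <| .ite 11 (.sub 11 5 1) (.add 11 1 21)

/-- One round of the computation of `2 ^ p`, counting down in register `4`. -/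
def doubleStep : Prog := .seq (.add 13 13 13) (.sub 4 4 5)

/-- Prepares the radicand in register `14` and the interval from register `15` to `16`. Register
`17` holds the length of the interval minus one. -/
def prepareSqrt : Prog :=
  .seq (.mul 14 13 13) <| .seq (.mul 14 10 14) <| .seq (.const 15 0) <| .seq (.add 16 14 5) <|
  .add 17 14 21

/-- One bisection step for the integer square root of register `14`. -/
def bisectStep : Prog :=
  .seq (.add 18 15 16) <| .seq (.div 18 18 19) <| .seq (.mul 20 18 18) <| .seq (.sub 20 20 14) <|
  .seq (.ite 20 (.add 16 18 21) (.add 15 18 21)) <| .seq (.sub 17 16 15) (.sub 17 17 5)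

/-- Moves the results to the output registers. -/
def writeOutput : Prog :=
  .seq (.div 2 15 19) <| .seq (.add 0 11 21) <| .seq (.add 1 9 21) <| .seq (.const 3 0) <|
  .seq (.const 4 0) (.const 5 0)

/-- The program that computes the rows of the crossing lines: half of the integer square root of
`(N - l) * (l + 1) * 4 ^ p` approximates the matrix entry. -/
def rowProg : Prog :=
  .seq findEntry <| .seq (.loop 4 doubleStep) <| .seq prepareSqrt <|
  .seq (.loop 17 bisectStep) writeOutput

lemma weight_eq {N l : ℕ} (hl : l ≤ N) :
    weight N l = √(((N - l) * (l + 1) : ℕ) : ℝ) / 2 := by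
  rw [weight]
  push_cast [Nat.cast_sub hl]
  rfl

lemma findEntry_eval {N : ℕ} (X : Fin N → Bool) (x : Site N) (i : Fin 2) (p : ℕ) :
    let s := findEntry.eval (bit X) (inputRegs x i p)
    s 4 = p ∧ s 5 = 1 ∧ s 13 = 1 ∧ s 19 = 2 ∧ s 21 = 0 ∧
      s 11 = (chainRow N X x i).1.1.toNat ∧ s 9 = (chainRow N X x i).1.2.val ∧
      (chainRow N X x i).2 = ((√(s 10) / 2 : ℝ) : ℂ) := by
  obtain ⟨k, j, hj⟩ := x
  by_cases h₀ : i.val = 0 ∧ j < N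
  · rw [chainRow_forward X _ i h₀.1 h₀.2]
    have h1 : N - j ≠ 0 := by omega
    simp only [weight_eq h₀.2.le]
    cases hb : bit X j <;>
    simp [findEntry, goForward, goBackward, Prog.eval, inputRegs, h₀.1, h1, hb]
    cases k <;> simp
  by_cases h₁ : 0 < j ∧ (i.val = 1 ↔ j < N)
  · rw [chainRow_backward X _ i h₁.1 h₁.2]
    simp only [weight_eq (show j - 1 ≤ N by omega)]
    have hj0 : j ≠ 0 := by omega
    have hj1 : j - 1 + 1 = j := by omega
    by_cases hN : j < N
    · have hi : i.val = 1 := h₁.2.2 hN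
      have h1 : N - j ≠ 0 := by omega
      cases hb : bit X (j - 1) <;>
      simp [findEntry, goForward, goBackward, Prog.eval, inputRegs, hi, h1, hj0, hb]
      cases k <;> simp
    · have hi : i.val = 0 := by omega
      have h1 : N - j = 0 := by omega
      cases hb : bit X (j - 1) <;>
      simp [findEntry, goForward, goBackward, Prog.eval, inputRegs, hi, h1, hj0, hb]
      cases k <;> simp
  · rw [chainRow_none X _ i h₀ h₁]
    by_cases hi : i.val = 0
    · obtain rfl : j = 0 := by omega
      obtain rfl : N = 0 := by omega
      simp [findEntry, goForward, goBackward, Prog.eval, inputRegs, hi]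
    · by_cases h1 : N - j = 0
      · simp [findEntry, goForward, goBackward, Prog.eval, inputRegs, hi, h1]
      · obtain rfl : j = 0 := by omega
        rw [Nat.sub_zero] at h1
        simp [findEntry, goForward, goBackward, Prog.eval, inputRegs, hi, h1]

lemma inputRegs_lt {N : ℕ} (x : Site N) (i : Fin 2) (p r : ℕ) :
    inputRegs x i p r < 2 ^ (N.size + p + 1) := by
  have h1 : 2 ^ N.size ≤ 2 ^ (N.size + p) := Nat.pow_le_pow_right two_pos (by omega)
  have h2 : 2 ^ p ≤ 2 ^ (N.size + p) := Nat.pow_le_pow_right two_pos (by omega)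
  have h3 := Nat.lt_size_self N
  have h4 : p < 2 ^ p := Nat.lt_two_pow_self
  have h5 := x.1.toNat_lt
  have h6 := x.2.isLt
  have h7 := i.isLt
  rw [pow_succ]
  unfold inputRegs
  split <;> omega

/-- The invariant of the doubling loop is that register `13` times `2` to the power of the counter
in register `4` equals `2 ^ p`. -/
lemma exists_exec_double {X : ℕ → Bool} {K B p : ℕ} (hK : doubleStep.GrowthBound K)
    (hB : p < B) {s₀ : ℕ → ℕ} (hs₀ : ∀ r, s₀ r < 2 ^ B) (h4 : s₀ 4 = p) (h5 : s₀ 5 = 1)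
    (h13 : s₀ 13 = 1) :
    ∃ s c, Exec X (.loop 4 doubleStep) s₀ s c ∧ c ≤ p * (1 + B + K * B) + 1 ∧
      (∀ r, s r < 2 ^ B) ∧ s 13 = 2 ^ p ∧ ∀ r, r ≠ 4 → r ≠ 13 → s r = s₀ r := by
  set I : ℕ → (ℕ → ℕ) → Prop := fun n s => s 4 = n ∧ n ≤ p ∧ s 13 * 2 ^ n = 2 ^ p ∧
    ∀ r, r ≠ 4 → r ≠ 13 → s r = s₀ r with hI
  have hbd : ∀ n s, I n s → ∀ r, s r < 2 ^ B := by
    rintro n s ⟨ha, hn, hT, hf⟩ r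
    have hp : p < 2 ^ p := Nat.lt_two_pow_self
    have hpB : 2 ^ p < 2 ^ B := Nat.pow_lt_pow_right (by norm_num) hB
    by_cases hr : r = 4
    · subst hr; omega
    by_cases hr' : r = 13
    · subst hr'
      have : s 13 ≤ 2 ^ p := hT ▸ Nat.le_mul_of_pos_right _ (by positivity)
      omega
    · rw [hf r hr hr']; exact hs₀ r
  obtain ⟨s, c, he, hc, ha, n, hn⟩ := exists_exec_loop (X := X) (a := 4) (body := doubleStep)
    (by simp [doubleStep, Prog.LoopFree]) hK (by omega : 1 ≤ B) I hbd
    (by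
      rintro n s ⟨ha, hn, hT, hf⟩ hne
      obtain ⟨n, rfl⟩ : ∃ m, n = m + 1 := ⟨n - 1, by omega⟩
      have h5' : s 5 = 1 := (hf 5 (by decide) (by decide)).trans h5
      refine ⟨n, rfl, ?_, by omega, ?_, fun r hr hr' => ?_⟩
      · simp [doubleStep, Prog.eval, h5', ha]
      · simp [doubleStep, Prog.eval]
        rw [← hT]; ring
      · simp [doubleStep, Prog.eval, hr, hr', hf])
    p s₀ ⟨h4, le_rfl, by simp [h13], fun _ _ _ => rfl⟩
  refine ⟨s, c, he, hc, hbd n s hn, ?_, hn.2.2.2⟩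
  obtain ⟨h1, -, h2, -⟩ := hn
  obtain rfl : n = 0 := by omega
  simpa using h2

/-- The bisection keeps the square root between registers `15` and `16`, and every round halves a
power of two that bounds the distance; squares of midpoints double the register length. -/
lemma exists_exec_bisect {X : ℕ → Bool} {K B m : ℕ} (hK : bisectStep.GrowthBound K)
    (hB : 2 * m + 2 ≤ B) {s₀ : ℕ → ℕ} (hs₀ : ∀ r, s₀ r < 2 ^ m) (h5 : s₀ 5 = 1)
    (h15 : s₀ 15 = 0) (h16 : s₀ 16 = s₀ 14 + 1) (h17 : s₀ 17 = s₀ 14) (h19 : s₀ 19 = 2)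
    (h21 : s₀ 21 = 0) :
    ∃ s c, Exec X (.loop 17 bisectStep) s₀ s c ∧ c ≤ m * (1 + B + K * B) + 1 ∧
      (∀ r, s r < 2 ^ B) ∧ s 15 = Nat.sqrt (s₀ 14) ∧
      ∀ r, r < 15 ∨ 18 < r ∧ r ≠ 20 → s r = s₀ r := by
  set n := s₀ 14 with hn14
  have hn : n < 2 ^ m := hs₀ 14
  have hmB : 2 ^ m ≤ 2 ^ B := Nat.pow_le_pow_right two_pos (by omega)
  have hnB : (n + 1) * (n + 1) < 2 ^ B := by
    calc (n + 1) * (n + 1) ≤ 2 ^ m * 2 ^ m := Nat.mul_le_mul hn hn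
      _ = 2 ^ (m + m) := (pow_add _ _ _).symm
      _ < 2 ^ B := Nat.pow_lt_pow_right (by norm_num) (by omega)
  have hnB' : n + 1 < 2 ^ B := (Nat.le_mul_of_pos_right _ (by omega)).trans_lt hnB
  set I : ℕ → (ℕ → ℕ) → Prop := fun l s =>
    s 15 * s 15 ≤ n ∧ n < s 16 * s 16 ∧ s 16 - s 15 ≤ 2 ^ l ∧ s 16 ≤ n + 1 ∧
    s 17 = s 16 - s 15 - 1 ∧ s 18 < 2 ^ B ∧ s 20 < 2 ^ B ∧
    ∀ r, r ≠ 15 → r ≠ 16 → r ≠ 17 → r ≠ 18 → r ≠ 20 → s r = s₀ r with hI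
  have hlt : ∀ l s, I l s → s 15 < s 16 := by
    rintro l s ⟨h1, h2, -⟩
    by_contra! h
    have := Nat.mul_le_mul h h
    omega
  have hbd : ∀ l s, I l s → ∀ r, s r < 2 ^ B := by
    intro l s hs r
    have h := hlt l s hs
    obtain ⟨h1, h2, h3, h4, h5, h6, h7, hf⟩ := hs
    by_cases r15 : r = 15
    · subst r15; omega
    by_cases r16 : r = 16
    · subst r16; omega
    by_cases r17 : r = 17
    · subst r17; omega
    by_cases r18 : r = 18
    · subst r18; omega
    by_cases r20 : r = 20
    · subst r20; omega
    rw [hf r r15 r16 r17 r18 r20]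
    exact (hs₀ r).trans_le hmB
  obtain ⟨s, c, he, hc, ha, l, hl⟩ := exists_exec_loop (X := X) (a := 17) (body := bisectStep)
    (by simp [bisectStep, Prog.LoopFree]) hK (by omega : 1 ≤ B) I hbd
    (by
      intro l s hs hne
      have h := hlt l s hs
      obtain ⟨h1, h2, h3, h4, hd, h6, h7, hf⟩ := hs
      have f5 : s 5 = 1 := (hf 5 (by decide) (by decide) (by decide) (by decide) (by decide)).trans h5
      have f14 : s 14 = n := hf 14 (by decide) (by decide) (by decide) (by decide) (by decide)
      have f19 : s 19 = 2 :=
        (hf 19 (by decide) (by decide) (by decide) (by decide) (by decide)).trans h19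
      have f21 : s 21 = 0 :=
        (hf 21 (by decide) (by decide) (by decide) (by decide) (by decide)).trans h21
      obtain ⟨l, rfl⟩ : ∃ l', l = l' + 1 := by
        refine ⟨l - 1, ?_⟩
        rcases Nat.eq_zero_or_pos l with rfl | h0
        · rw [pow_zero] at h3; omega
        · omega
      rw [pow_succ] at h3
      set mid := (s 15 + s 16) / 2 with hmid
      have hm1 : mid ≤ n + 1 := by omega
      have hm2 : mid * mid ≤ (n + 1) * (n + 1) := Nat.mul_le_mul hm1 hm1
      refine ⟨l, rfl, ?_⟩
      by_cases hle : mid * mid ≤ n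
      · have h0 : mid * mid - n = 0 := by omega
        simp [hI, bisectStep, Prog.eval, Function.update_apply, f5, f14, f19, f21, ← hmid, h0]
        refine ⟨hle, h2, by omega, h4, by omega, fun r r15 r16 r17 r18 r20 => ?_⟩
        simp [*]
      · have h0 : mid * mid - n ≠ 0 := by omega
        simp [hI, bisectStep, Prog.eval, Function.update_apply, f5, f14, f19, f21, ← hmid, h0]
        refine ⟨h1, by omega, by omega, by omega, by omega, by omega,
          fun r r15 r16 r17 r18 r20 => ?_⟩
        simp [*])
    m s₀ (by
      refine ⟨by simp [h15], ?_, by omega, by omega, by omega, ?_, ?_, by simp⟩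
      · rw [h16]; nlinarith
      · exact (hs₀ 18).trans_le hmB
      · exact (hs₀ 20).trans_le hmB)
  have h := hlt l s hl
  refine ⟨s, c, he, hc, hbd l s hl, ?_, fun r hr => ?_⟩
  · obtain ⟨h1, h2, -, -, hd, -⟩ := hl
    rw [Nat.eq_sqrt]
    have : s 16 = s 15 + 1 := by omega
    rw [this] at h2
    exact ⟨h1, h2⟩
  · exact hl.2.2.2.2.2.2.2 r (by omega) (by omega) (by omega) (by omega) (by omega)

/-- Rounding down the square root and then its half costs at most one unit in the last place. -/
lemma abs_sqrt_div_two_sub_le (M p : ℕ) :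
    |((Nat.sqrt (M * (2 ^ p * 2 ^ p)) / 2 : ℕ) : ℝ) / 2 ^ p - √M / 2| ≤ 1 / 2 ^ p := by
  set T : ℝ := 2 ^ p with hT
  have hTpos : 0 < T := by positivity
  set r := Nat.sqrt (M * (2 ^ p * 2 ^ p)) with hr
  have e : √((M * (2 ^ p * 2 ^ p) : ℕ) : ℝ) = √M * T := by
    push_cast
    rw [Real.sqrt_mul (by positivity), Real.sqrt_mul_self (by positivity)]
  have h1 : (r : ℝ) ≤ √M * T := e ▸ Real.nat_sqrt_le_real_sqrt
  have h2 : √M * T < r + 1 := by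
    rw [← e]; exact Real.real_sqrt_lt_nat_sqrt_succ
  have h3 : (2 * (r / 2 : ℕ) : ℝ) ≤ r := by exact_mod_cast Nat.mul_div_le r 2
  have h4 : (r : ℝ) ≤ 2 * (r / 2 : ℕ) + 1 := by
    have : r ≤ 2 * (r / 2) + 1 := by omega
    exact_mod_cast this
  have e2 : ((r / 2 : ℕ) : ℝ) / T - √M / 2 = (((r / 2 : ℕ) : ℝ) - √M * T / 2) / T := by
    field_simp
  rw [e2, abs_div, abs_of_pos hTpos]
  gcongr
  rw [abs_le]
  constructor <;> linarith

lemma rowComputable_chainRow : RowComputable chainRow := by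
  obtain ⟨K₁, hK₁⟩ := findEntry.exists_growthBound
  obtain ⟨K₂, hK₂⟩ := doubleStep.exists_growthBound
  obtain ⟨K₃, hK₃⟩ := prepareSqrt.exists_growthBound
  obtain ⟨K₄, hK₄⟩ := bisectStep.exists_growthBound
  obtain ⟨K₅, hK₅⟩ := writeOutput.exists_growthBound
  set L₁ := K₁ + 1 with hL₁
  set L₂ := K₃ * L₁ with hL₂
  set L₃ := 2 * L₂ + 2 with hL₃
  set C := K₁ + (1 + L₁ + K₂ * L₁) + 1 + L₂ + L₂ * (1 + L₃ + K₄ * L₃) + 1 + K₅ * L₃ with hC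
  refine ⟨rowProg, C + 2, fun N X x i p => ?_⟩
  set b := N.size + p + 1 with hb
  have hb1 : 1 ≤ b := by omega
  obtain ⟨hc₁, hs₁⟩ := hK₁.2 (bit X) b _ hb1 (inputRegs_lt x i p)
  obtain ⟨a4, a5, a13, a19, a21, a11, a9, aval⟩ := findEntry_eval X x i p
  set s₁ := findEntry.eval (bit X) (inputRegs x i p) with hs₁def
  have hL₁b : K₁ * b ≤ L₁ * b := Nat.mul_le_mul_right _ (by omega)
  obtain ⟨s₂, c₂, he₂, hc₂, hs₂, b13, hf₂⟩ := exists_exec_double (X := bit X) (p := p)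
    (B := L₁ * b) hK₂ (by
      have : 1 * b ≤ L₁ * b := Nat.mul_le_mul_right _ (by omega)
      omega)
    (fun r => (hs₁ r).trans_le (Nat.pow_le_pow_right two_pos hL₁b)) a4 a5 a13
  obtain ⟨hc₃, hs₃⟩ := hK₃.2 (bit X) (L₁ * b) s₂ (Nat.mul_pos (by omega) hb1) hs₂
  rw [← mul_assoc, ← hL₂] at hc₃ hs₃
  have b5 := (hf₂ 5 (by decide) (by decide)).trans a5
  have b9 := (hf₂ 9 (by decide) (by decide)).trans a9
  have b10 := hf₂ 10 (by decide) (by decide)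
  have b11 := (hf₂ 11 (by decide) (by decide)).trans a11
  have b19 := (hf₂ 19 (by decide) (by decide)).trans a19
  have b21 := (hf₂ 21 (by decide) (by decide)).trans a21
  set s₃ := prepareSqrt.eval (bit X) s₂ with hs₃def
  have d5 : s₃ 5 = 1 := by simpa [hs₃def, prepareSqrt, Prog.eval] using b5
  have d9 : s₃ 9 = (chainRow N X x i).1.2.val := by
    simpa [hs₃def, prepareSqrt, Prog.eval] using b9
  have d11 : s₃ 11 = (chainRow N X x i).1.1.toNat := by
    simpa [hs₃def, prepareSqrt, Prog.eval] using b11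
  have d14 : s₃ 14 = s₁ 10 * (2 ^ p * 2 ^ p) := by
    simp [hs₃def, prepareSqrt, Prog.eval, b10, b13]
  have d15 : s₃ 15 = 0 := by simp [hs₃def, prepareSqrt, Prog.eval]
  have d16 : s₃ 16 = s₃ 14 + 1 := by
    simp [hs₃def, prepareSqrt, Prog.eval, b5]
  have d17 : s₃ 17 = s₃ 14 := by
    simp [hs₃def, prepareSqrt, Prog.eval, b21]
  have d19 : s₃ 19 = 2 := by
    simpa [hs₃def, prepareSqrt, Prog.eval] using b19
  have d21 : s₃ 21 = 0 := by
    simpa [hs₃def, prepareSqrt, Prog.eval] using b21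
  obtain ⟨s₄, c₄, he₄, hc₄, hs₄, e15, hf₄⟩ := exists_exec_bisect (X := bit X) (m := L₂ * b)
    (B := L₃ * b) hK₄ (by
      have : L₃ * b = 2 * (L₂ * b) + 2 * b := by rw [hL₃]; ring
      omega)
    hs₃ d5 d15 d16 d17 d19 d21
  obtain ⟨hc₅, -⟩ := hK₅.2 (bit X) (L₃ * b) s₄ (Nat.mul_pos (by omega) hb1) hs₄
  have e9 := (hf₄ 9 (by decide)).trans d9
  have e11 := (hf₄ 11 (by decide)).trans d11
  have e19 := (hf₄ 19 (by decide)).trans d19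
  have e21 := (hf₄ 21 (by decide)).trans d21
  refine ⟨writeOutput.eval (bit X) s₄, _,
    .seq _ _ _ _ _ _ _ (Prog.LoopFree.exec (by
      simp [findEntry, goForward, goBackward, Prog.LoopFree]) _) <|
    .seq _ _ _ _ _ _ _ he₂ <|
    .seq _ _ _ _ _ _ _ (Prog.LoopFree.exec (by simp [prepareSqrt, Prog.LoopFree]) _) <|
    .seq _ _ _ _ _ _ _ he₄ (Prog.LoopFree.exec (by simp [writeOutput, Prog.LoopFree]) _),
    ?_, ?_, ?_, ?_⟩
  · -- with all register lengths linear in `b`, the total cost is at most `C * b ^ 2`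
    have hbb : b ≤ b ^ 2 := Nat.le_self_pow two_ne_zero b
    have t₁ : K₁ * b ≤ K₁ * b ^ 2 := Nat.mul_le_mul_left _ hbb
    have t₂ : p * (1 + L₁ * b + K₂ * (L₁ * b)) ≤ (1 + L₁ + K₂ * L₁) * b ^ 2 := by
      calc p * (1 + L₁ * b + K₂ * (L₁ * b)) ≤ b * (b + L₁ * b + K₂ * (L₁ * b)) := by
            gcongr
            omega
        _ = _ := by ring
    have t₃ : L₂ * b ≤ L₂ * b ^ 2 := Nat.mul_le_mul_left _ hbb
    have t₄ : L₂ * b * (1 + L₃ * b + K₄ * (L₃ * b)) ≤ L₂ * (1 + L₃ + K₄ * L₃) * b ^ 2 := by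
      calc L₂ * b * (1 + L₃ * b + K₄ * (L₃ * b)) ≤ L₂ * b * (b + L₃ * b + K₄ * (L₃ * b)) := by
            gcongr
        _ = _ := by ring
    have t₅ : K₅ * (L₃ * b) ≤ K₅ * L₃ * b ^ 2 := by
      rw [← mul_assoc]
      exact Nat.mul_le_mul_left _ hbb
    have total : C * b ^ 2 ≤ (C + 2) * b ^ (C + 2) :=
      Nat.mul_le_mul (by omega) (Nat.pow_le_pow_right hb1 (by omega))
    refine le_trans ?_ total
    have e : C * b ^ 2 = K₁ * b ^ 2 + (1 + L₁ + K₂ * L₁) * b ^ 2 + b ^ 2 + L₂ * b ^ 2 +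
        L₂ * (1 + L₃ + K₄ * L₃) * b ^ 2 + b ^ 2 + K₅ * L₃ * b ^ 2 := by
      rw [hC]; ring
    omega
  · simpa [writeOutput, Prog.eval, e21] using e11
  · simpa [writeOutput, Prog.eval, e21] using e9
  · have h := abs_sqrt_div_two_sub_le (s₁ 10) p
    rw [← d14, ← e15, ← Real.norm_eq_abs, ← Complex.norm_real] at h
    rw [aval]
    simpa [writeOutput, Prog.eval, e19] using h

end HamSim

theorem theorem3 :
    -- the rows of the Hamiltonians can be computed efficiently
    HamSim.RowComputable HamSim.chainRow ∧
    -- for every `N` ...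
    (∀ N : ℕ, 0 < N →
      -- they are 2-sparse Hamiltonians, with the stated black box and scaled time
      (∀ X : Fin N → Bool,
        (HamSim.chainH N X).IsHermitian ∧
        HamSim.IsSparse 2 (HamSim.chainH N X) ∧
        HamSim.IsRowOracle (HamSim.chainH N X) (HamSim.chainRow N X) ∧
        HamSim.scaledTime (HamSim.chainH N X) Real.pi = Real.pi * N / 2) ∧
      -- and simulating all of them within precision 1/4 needs at least `τ / 2π` queries
      (∀ (b : ℕ) (enc : HamSim.Site N × ℂ → Fin b → Bool)
          (A : HamSim.QueryAlg (HamSim.Site N) 2 b),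
        (∀ X : Fin N → Bool,
          A.Simulates enc (HamSim.chainRow N X) (HamSim.chainH N X) Real.pi (1 / 4)) →
        (Real.pi * N / 2) / (2 * Real.pi) ≤ (A.queries : ℝ))) ∧
    -- hence no simulation is sublinear in the scaled time
    (∀ g : ℝ → ℝ,
      (∀ N : ℕ, 0 < N → ∃ (b : ℕ) (enc : HamSim.Site N × ℂ → Fin b → Bool)
          (A : HamSim.QueryAlg (HamSim.Site N) 2 b),
        (∀ X : Fin N → Bool,
          A.Simulates enc (HamSim.chainRow N X) (HamSim.chainH N X) Real.pi (1 / 4)) ∧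
        (A.queries : ℝ) ≤ g (Real.pi * N / 2)) →
      ¬ Asymptotics.IsLittleO Filter.atTop g (fun τ : ℝ => τ)) := by
  have hpi := Real.pi_pos
  have bound : ∀ (N b : ℕ) (enc : HamSim.Site N × ℂ → Fin b → Bool)
      (A : HamSim.QueryAlg (HamSim.Site N) 2 b),
      (∀ X : Fin N → Bool,
        A.Simulates enc (HamSim.chainRow N X) (HamSim.chainH N X) Real.pi (1 / 4)) →
      (N : ℝ) / 2 ≤ A.queries := fun N b enc A hA => by
    have : (N : ℝ) ≤ 2 * A.queries := by exact_mod_cast HamSim.le_two_mul_queries enc A hA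
    linarith
  refine ⟨HamSim.rowComputable_chainRow, fun N _ => ⟨fun X => ?_, fun b enc A hA => ?_⟩,
    fun g hg hlo => ?_⟩
  · exact ⟨HamSim.chainH_isHermitian X,
      (HamSim.chainRow_isRowOracle X).isSparse (HamSim.chainH_isHermitian X),
      HamSim.chainRow_isRowOracle X, by rw [HamSim.scaledTime, HamSim.norm_chainH]; ring⟩
  · have e : (Real.pi * N / 2) / (2 * Real.pi) = (N : ℝ) / 4 := by
      field_simp
      norm_num
    have := bound N b enc A hA
    have : (0 : ℝ) ≤ N := Nat.cast_nonneg N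
    rw [e]
    linarith
  · -- along `τ = π N / 2` the number of queries is at least `τ / π`
    have hτ : Filter.Tendsto (fun N : ℕ => Real.pi * N / 2) Filter.atTop Filter.atTop :=
      (tendsto_natCast_atTop_atTop.const_mul_atTop hpi).atTop_div_const two_pos
    have hsmall := hτ.eventually (hlo.def (c := 1 / (2 * Real.pi)) (by positivity))
    obtain ⟨N, hN, hN0⟩ := (hsmall.and (Filter.eventually_gt_atTop 0)).exists
    obtain ⟨b, enc, A, hA, hQ⟩ := hg N hN0
    have h1 := bound N b enc A hA
    have h2 : (0 : ℝ) < N := by exact_mod_cast hN0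
    have e : 1 / (2 * Real.pi) * ‖Real.pi * N / 2‖ = (N : ℝ) / 4 := by
      rw [Real.norm_of_nonneg (by positivity)]
      field_simp
      norm_num
    rw [e] at hN
    have h3 := (Real.le_norm_self _).trans hN
    linarith
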